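/- Identify the split quaternions with $\mathbb R^4$, with Lebesgue measure $dV$ and $N(X)=x_1^2+x_2^2-x_3^2-x_4^2$, and the dual space with $\mathbb R^4$ through $\xi\cdot X=\xi_1x_1+\xi_2x_2+\xi_3x_3+\xi_4x_4$. Put $\langle\xi,\xi'\rangle=\xi_1\xi'_1+\xi_2\xi'_2-\xi_3\xi'_3-\xi_4\xi'_4$ and $C^*=\{\xi:\langle\xi,\xi\rangle=0\}$. Let $J_0,Y_0,K_0$ be the usual Bessel functions of order $0$, and for $t\neq0$ define $$\Psi_0(t)=\begin{cases}Y_0(2\sqrt{2t}),&t>0,\\-\frac2\pi K_0(2\sqrt{-2t}),&t<0,\end{cases}\qquad \Phi_0^+(t)=\begin{cases}J_0(2\sqrt{2t}),&t>0,\\0,&t<0.\end{cases}$$ Let $R>0$ and let $\xi,\xi'\in C^*$ with $\langle\xi,\xi'\rangle\ne0$. Then $$\lim_{\epsilon\to0^+}\frac1{4\pi^2}\int_{\mathbb R^4}\left(\frac{e^{i(\xi-\xi')\cdot X}}{(N(X)-4+i\epsilon)^2}+\frac{e^{i(\xi-\xi')\cdot X}}{(N(X)-4-i\epsilon)^2}\right)dV=\frac\pi2\,\Psi_0\bigl(-\langle\xi,\xi'\rangle\bigr)$$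 (the kernel of Kobayashi and Mano, up to a constant factor), and $$\lim_{\epsilon\to0^+}\frac1{4\pi^2}\int_{\mathbb R^4}\left(\frac{e^{i(\xi-\xi')\cdot X}}{(N(X)-R^2+i\epsilon)^2}-\frac{e^{i(\xi-\xi')\cdot X}}{(N(X)-R^2-i\epsilon)^2}\right)dV=\begin{cases}0,&\langle\xi,\xi'\rangle>0,\\\frac{\pi i}2J_0\bigl(R\sqrt{-2\langle\xi,\xi'\rangle}\bigr),&\langle\xi,\xi'\rangle<0\end{cases}=\frac{\pi i}2\,\Phi_0^+\Bigl(-\frac{R^2}4\langle\xi,\xi'\rangle\Bigr).$$ The integrals do not converge absolutely. They denote the Fourier transform of tempered distributions, normalized by $\hat\psi(\eta)=\frac1{(2\pi)^2}\int\psi(X)e^{i\eta\cdot X}dV$, in the following sense. For every $\epsilon>0$ the transform of the kernel $g_\epsilon$ (the sum, or the difference, of the two fractions without the exponential) is given by a function on $\mathbb R^4$ that is continuous off $C^*$. As $\epsilon\to0^+$ these functions converge, both pointwise off $C^*$ and as tempered distributions, to a function that is continuous off $C^*$ and defines a tempered distribution by integration. The two displayed formulas give the values of this limit function at the points $\eta=\xi-\xi'$.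 -/

import Mathlib

open scoped SchwartzMap Topology

noncomputable section

namespace SplitQuaternion

/-- The space of split quaternions in its real coordinates `(x₁, x₂, x₃, x₄)`, with Lebesgue
measure `dx₁ dx₂ dx₃ dx₄`.  The dual space is identified with the same coordinate space through
`ξ · X = ξ₁ x₁ + ξ₂ x₂ + ξ₃ x₃ + ξ₄ x₄`, which is `inner ℝ ξ X`. -/
abbrev HR : Type := EuclideanSpace ℝ (Fin 4)

/-- The `2 × 2` complex matrix of a split quaternion. -/
def toMatrix (X : HR) : Matrix (Fin 2) (Fin 2) ℂ :=
  !![(X 0 : ℂ) - Complex.I * X 1, (X 2 : ℂ) + Complex.I * X 3;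
     (X 2 : ℂ) - Complex.I * X 3, (X 0 : ℂ) + Complex.I * X 1]

/-- The symmetric bilinear form of signature `(2, 2)`. -/
def form (ξ ξ' : HR) : ℝ := ξ 0 * ξ' 0 + ξ 1 * ξ' 1 - ξ 2 * ξ' 2 - ξ 3 * ξ' 3

/-- The quadratic norm `N(X) = x₁² + x₂² - x₃² - x₄²`. -/
def N (X : HR) : ℝ := X 0 ^ 2 + X 1 ^ 2 - X 2 ^ 2 - X 3 ^ 2

theorem det_toMatrix (X : HR) : (toMatrix X).det = (N X : ℂ) := by
  have h := Complex.I_sq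
  simp only [toMatrix, Matrix.det_fin_two_of, N]
  push_cast
  linear_combination (-(X 1 : ℂ) ^ 2 + (X 3 : ℂ) ^ 2) * h

/-- The null cone `C^*` of the dual space. -/
def nullCone : Set HR := {ξ | form ξ ξ = 0}

/-- The Bessel function of the first kind of order `0`. -/
def besselJ0 (x : ℝ) : ℝ := ∑' k : ℕ, (-1) ^ k * (x ^ 2 / 4) ^ k / (k.factorial : ℝ) ^ 2

/-- The modified Bessel function of the first kind of order `0`. -/
def besselI0 (x : ℝ) : ℝ := ∑' k : ℕ, (x ^ 2 / 4) ^ k / (k.factorial : ℝ) ^ 2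

/-- The Bessel function of the second kind of order `0`, for `x > 0`; here
`harmonic k = 1 + 1/2 + ⋯ + 1/k`. -/
def besselY0 (x : ℝ) : ℝ :=
  2 / Real.pi * ((Real.log (x / 2) + Real.eulerMascheroniConstant) * besselJ0 x
    - ∑' k : ℕ, (-1) ^ k * ((harmonic k : ℚ) : ℝ) * (x ^ 2 / 4) ^ k / (k.factorial : ℝ) ^ 2)

/-- The modified Bessel function of the second kind of order `0`, for `x > 0`. -/
def besselK0 (x : ℝ) : ℝ :=
  -(Real.log (x / 2) + Real.eulerMascheroniConstant) * besselI0 x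
    + ∑' k : ℕ, ((harmonic k : ℚ) : ℝ) * (x ^ 2 / 4) ^ k / (k.factorial : ℝ) ^ 2

/-- The Kobayashi–Mano function `Ψ₀(t)`, for `t ≠ 0` (the value at `0` carries no meaning). -/
def Psi0 (t : ℝ) : ℝ :=
  if 0 < t then besselY0 (2 * √(2 * t)) else -(2 / Real.pi) * besselK0 (2 * √(-2 * t))

/-- The function `Φ₀⁺(t)`, for `t ≠ 0` (the value at `0` carries no meaning). -/
def Phi0Plus (t : ℝ) : ℝ :=
  if 0 < t then besselJ0 (2 * √(2 * t)) else 0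

/-- `X ↦ (N(X) - c + iε)⁻² + (N(X) - c - iε)⁻²`. -/
def sumKernel (c ε : ℝ) (X : HR) : ℂ :=
  1 / ((N X : ℂ) - c + Complex.I * ε) ^ 2 + 1 / ((N X : ℂ) - c - Complex.I * ε) ^ 2

/-- `X ↦ (N(X) - c + iε)⁻² - (N(X) - c - iε)⁻²`. -/
def diffKernel (c ε : ℝ) (X : HR) : ℂ :=
  1 / ((N X : ℂ) - c + Complex.I * ε) ^ 2 - 1 / ((N X : ℂ) - c - Complex.I * ε) ^ 2

/-- The Fourier transform `φ̂(ξ) = (2π)⁻² ∫ φ(X) e^{i ξ·X} dX` of an integrable function. -/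
def fourier (φ : HR → ℂ) (ξ : HR) : ℂ :=
  1 / (2 * Real.pi) ^ 2 * ∫ X, φ X * Complex.exp (Complex.I * (inner ℝ ξ X : ℝ))

/-- The function `F` is the Fourier transform of the function `g` in the sense of tempered
distributions: `∫ F φ = ∫ g φ̂` for every Schwartz function `φ`. -/
def IsFourierTransform (g F : HR → ℂ) : Prop :=
  ∀ φ : 𝓢(HR, ℂ),
    MeasureTheory.Integrable (fun X => g X * fourier φ X) ∧
    MeasureTheory.Integrable (fun ξ => F ξ * φ ξ) ∧
    ∫ ξ, F ξ * φ ξ = ∫ X, g X * fourier φ X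

/-- The function `F` is the limit, as `ε → 0⁺`, of the Fourier transforms of the functions `g ε`,
both in the sense of tempered distributions and pointwise off the null cone.  All transforms are
represented by functions that are continuous off the null cone, which pins their values there. -/
structure IsLimitFourierTransform (g : ℝ → HR → ℂ) (F : HR → ℂ) : Prop where
  continuousOn : ContinuousOn F nullConeᶜ
  integrable : ∀ φ : 𝓢(HR, ℂ), MeasureTheory.Integrable (fun ξ => F ξ * φ ξ)
  /-- The tempered distributions `g ε` converge, and `F` is the Fourier transform of the limit. -/
  distributional : ∀ φ : 𝓢(HR, ℂ),
    Filter.Tendsto (fun ε => ∫ X, g ε X * fourier φ X) (𝓝[>] 0) (𝓝 (∫ ξ, F ξ * φ ξ))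
  /-- The transform of each `g ε` is a function, and these functions converge pointwise to `F`. -/
  pointwise : ∃ G : ℝ → HR → ℂ,
    (∀ ε > 0, ContinuousOn (G ε) nullConeᶜ ∧ IsFourierTransform (g ε) (G ε)) ∧
    ∀ η ∉ nullCone, Filter.Tendsto (fun ε => G ε η) (𝓝[>] 0) (𝓝 (F η))

end SplitQuaternion

end

/-!
The two kernels are superpositions of oscillating Gaussians. For `σ = ±1` and `a = ε + iσc`,

  `(N(X) - c + iσε)⁻² = -(a - iσN(X))⁻² = -∫₀^∞ t e^{-at} e^{iσtN(X)} dt`,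

and, since `N` has signature `(2, 2)`, the Fourier transform of `e^{iσtN}` is
`(4t²)⁻¹ e^{-iσN/(4t)}` without any phase factor (`integral_cexp_N_mul_fourier`). So the transform of `(a - iσN)⁻²` ought to
be `¼ k(a, iσN(η)/4)` with the Macdonald integral

  `k(a, b) = ∫₀^∞ e^{-at - b/t} dt/t = 2 K₀(2 √(ab))`.

For imaginary `b` this integral is only conditionally convergent. It is therefore regularized by the
factor `e^{-d/t}`, which replaces `b` by `b + d`, and Fubini's theorem applies
(`integral_regularized_mul_fourier`). Two facts about `k` allow `d → 0` and then `ε → 0`.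

* In the open right half-planes `k(a, b) = -(log a + log b + 2γ) A(ab) + 2 B(ab)` with the entire
  functions `A(w) = ∑ wᵏ/(k!)²` and `B(w) = ∑ Hₖ wᵏ/(k!)²`
  (`macdonaldIntegral_eq_macdonaldSeries`). Both sides, along the ray `r ↦ (a, rb)`, solve the
  Bessel equation `(r u')' = ab u`, and they have the same asymptotics `-log r - log a - log b - 2γ` at
  `r = 0`; a solution of the Bessel equation that vanishes at `0` together with `r u'` is zero. The
  right-hand side extends continuously to all `a` and `b` off `(-∞, 0]`, which yields the
  pointwise limits and the continuity off the null cone.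
* `|k(a, b)| ≤ 16 (1 + (|a| |b|)^{-1/4})` uniformly (`norm_macdonaldIntegral_le`). Away from the
  stationary scale `t = √(|b|/|a|)` one integrates by parts; near it the trivial estimate costs a
  logarithm. As `|N|^{-1/4}` is integrable against Schwartz functions
  (`integrable_abs_N_rpow_mul`), dominated convergence gives the limits as tempered distributions.

At `ε = 0` the product `ab` is the real number `-cN(η)/4` and `log a + log b` is
`log |cN(η)/4|`, plus `iσπ` when `N(η) > 0`. The series then turn into `K₀` for `N(η) < 0`, and for
`N(η) > 0` into a Hankel function, whose sum and difference with its conjugate are multiples of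
`Y₀` and `J₀`.
-/

noncomputable section

namespace SplitQuaternion

/-! ### The series of the Bessel functions of order zero -/

lemma summable_norm_mul_pow_of_le_div_factorial {c : ℕ → ℂ} {K : ℝ}
    (hc : ∀ k, ‖c k‖ ≤ K / k.factorial) (z : ℂ) : Summable fun k => c k * z ^ k := by
  refine Summable.of_norm_bounded (g := fun k => K * (‖z‖ ^ k / k.factorial))
    ((Real.summable_pow_div_factorial ‖z‖).mul_left K) fun k => ?_
  rw [norm_mul, norm_pow]
  calc ‖c k‖ * ‖z‖ ^ k ≤ K / k.factorial * ‖z‖ ^ k := by gcongr; exact hc k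
    _ = K * (‖z‖ ^ k / k.factorial) := by ring

lemma hasDerivAt_tsum_mul_pow {c : ℕ → ℂ} {K : ℝ} (hc : ∀ k, ‖c k‖ ≤ K / k.factorial) (z : ℂ) :
    HasDerivAt (fun z => ∑' k, c k * z ^ k) (∑' k : ℕ, ((k : ℂ) + 1) * c (k + 1) * z ^ k) z := by
  have hshift : ∀ k : ℕ, K / (k + 1).factorial * ((k + 1 : ℕ) : ℝ) = K / k.factorial := fun k => by
    have := k.factorial_ne_zero
    rw [Nat.factorial_succ]; push_cast; field_simp
  have hu : Summable fun k : ℕ => K / k.factorial * (k * (‖z‖ + 1) ^ (k - 1)) := by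
    rw [← summable_nat_add_iff 1]
    refine ((Real.summable_pow_div_factorial (‖z‖ + 1)).mul_left K).congr fun k => ?_
    rw [← mul_assoc, hshift]; simp; ring
  have h := hasDerivAt_tsum_of_isPreconnected (g := fun k z => c k * z ^ k)
    (g' := fun k z => c k * (k * z ^ (k - 1))) (y₀ := z) (y := z) (t := Metric.ball 0 (‖z‖ + 1)) hu
    Metric.isOpen_ball (convex_ball 0 _).isPreconnected
    (fun k y _ => (hasDerivAt_pow k y).const_mul (c k)) (fun k y hy => ?_) (by simp)
    (summable_norm_mul_pow_of_le_div_factorial hc z) (by simp)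
  · refine h.congr_deriv ?_
    have hs : Summable fun k : ℕ => c k * (k * z ^ (k - 1)) := by
      refine Summable.of_norm_bounded hu fun k => ?_
      simp only [norm_mul, norm_pow, Complex.norm_natCast]
      gcongr
      · exact (norm_nonneg _).trans (hc k)
      · exact hc k
      · simp
    rw [hs.tsum_eq_zero_add]
    simp only [Nat.cast_zero, zero_mul, mul_zero, zero_add, Nat.add_sub_cancel]
    exact tsum_congr fun k => by push_cast; ring
  · have : ‖y‖ < ‖z‖ + 1 := by simpa using hy
    simp only [norm_mul, norm_pow, Complex.norm_natCast]
    gcongr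
    · exact (norm_nonneg _).trans (hc k)
    · exact hc k

/-- The derivative of `z · ∑ cₖ zᵏ`. -/
lemma hasDerivAt_mul_tsum_mul_pow {c : ℕ → ℂ} {K : ℝ} (hc : ∀ k, ‖c k‖ ≤ K / (k + 1).factorial)
    (z : ℂ) : HasDerivAt (fun z => z * ∑' k, c k * z ^ k) (∑' k : ℕ, ((k : ℂ) + 1) * c k * z ^ k)
      z := by
  have hK : 0 ≤ K := by simpa using (norm_nonneg _).trans (hc 0)
  let d : ℕ → ℂ := fun k => k.casesOn 0 c
  have hd : ∀ k, ‖d k‖ ≤ K / k.factorial := by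
    rintro (_ | k)
    · simpa [d] using hK
    · exact hc k
  have hf : (fun z => z * ∑' k, c k * z ^ k) = fun z => ∑' k, d k * z ^ k := by
    funext z
    rw [(summable_norm_mul_pow_of_le_div_factorial hd z).tsum_eq_zero_add, ← tsum_mul_left,
      show d 0 = 0 from rfl, zero_mul, zero_add]
    refine tsum_congr fun k => ?_
    rw [show d (k + 1) = c k from rfl]
    ring
  rw [hf]
  exact hasDerivAt_tsum_mul_pow hd z

/-- The entire function `A(w) = ∑ wᵏ / (k!)²`, so that `I₀(x) = A(x² / 4)` and
`J₀(x) = A(-x² / 4)`. -/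
def besselSeries (w : ℂ) : ℂ := ∑' k : ℕ, 1 / (k.factorial : ℂ) ^ 2 * w ^ k

/-- The entire function `B(w) = ∑ Hₖ wᵏ / (k!)²`, where `Hₖ` is the `k`-th harmonic number. -/
def harmonicSeries (w : ℂ) : ℂ := ∑' k : ℕ, ((harmonic k : ℚ) : ℂ) / (k.factorial : ℂ) ^ 2 * w ^ k

/-- The derivative of `besselSeries`. -/
def besselSeriesDeriv (w : ℂ) : ℂ :=
  ∑' k : ℕ, 1 / ((k.factorial : ℂ) * (k + 1).factorial) * w ^ k

/-- The derivative of `harmonicSeries`. -/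
def harmonicSeriesDeriv (w : ℂ) : ℂ :=
  ∑' k : ℕ, ((harmonic (k + 1) : ℚ) : ℂ) / ((k.factorial : ℂ) * (k + 1).factorial) * w ^ k

lemma one_le_factorial_real (k : ℕ) : (1 : ℝ) ≤ k.factorial := by
  exact_mod_cast k.factorial_pos

lemma harmonic_le_self (k : ℕ) : harmonic k ≤ k := by
  induction k with
  | zero => simp
  | succ k ih =>
    rw [harmonic_succ]
    have : ((k + 1 : ℕ) : ℚ)⁻¹ ≤ 1 :=
      inv_le_one_of_one_le₀ (by push_cast; linarith [k.cast_nonneg (α := ℚ)])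
    push_cast at *
    linarith

lemma norm_harmonic_le (k : ℕ) : ‖((harmonic k : ℚ) : ℂ)‖ ≤ k := by
  have h0 : (0 : ℝ) ≤ ((harmonic k : ℚ) : ℝ) := by
    rcases k.eq_zero_or_pos with rfl | h
    · simp
    · exact_mod_cast (harmonic_pos h.ne').le
  have h1 : ((harmonic k : ℚ) : ℝ) ≤ k := by exact_mod_cast harmonic_le_self k
  calc ‖((harmonic k : ℚ) : ℂ)‖ = ‖(((harmonic k : ℚ) : ℝ) : ℂ)‖ := by push_cast; rfl
    _ ≤ k := by rw [Complex.norm_real, Real.norm_of_nonneg h0]; exact h1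

lemma norm_besselSeries_coeff_le (k : ℕ) : ‖1 / (k.factorial : ℂ) ^ 2‖ ≤ 1 / k.factorial := by
  have := one_le_factorial_real k
  rw [norm_div, norm_pow, Complex.norm_natCast, norm_one]
  gcongr
  nlinarith

lemma norm_harmonicSeries_coeff_le (k : ℕ) :
    ‖((harmonic k : ℚ) : ℂ) / (k.factorial : ℂ) ^ 2‖ ≤ 1 / k.factorial := by
  have := one_le_factorial_real k
  rw [norm_div, norm_pow, Complex.norm_natCast]
  calc ‖((harmonic k : ℚ) : ℂ)‖ / (k.factorial : ℝ) ^ 2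
      ≤ (k.factorial : ℝ) / (k.factorial : ℝ) ^ 2 := by
        gcongr
        exact (norm_harmonic_le k).trans (by exact_mod_cast k.self_le_factorial)
    _ = 1 / (k.factorial : ℝ) := by field_simp

lemma norm_besselSeriesDeriv_coeff_le (k : ℕ) :
    ‖1 / ((k.factorial : ℂ) * (k + 1).factorial)‖ ≤ 1 / (k + 1).factorial := by
  have h1 := one_le_factorial_real k
  have h2 := one_le_factorial_real (k + 1)
  rw [norm_div, norm_mul, Complex.norm_natCast, Complex.norm_natCast, norm_one]
  gcongr
  nlinarith

lemma norm_harmonicSeriesDeriv_coeff_le (k : ℕ) :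
    ‖((harmonic (k + 1) : ℚ) : ℂ) / ((k.factorial : ℂ) * (k + 1).factorial)‖ ≤
      2 / (k + 1).factorial := by
  have h1 := one_le_factorial_real k
  have h2 := one_le_factorial_real (k + 1)
  have h3 : (k : ℝ) ≤ k.factorial := by exact_mod_cast k.self_le_factorial
  rw [norm_div, norm_mul, Complex.norm_natCast, Complex.norm_natCast,
    div_le_div_iff₀ (by positivity) (by positivity)]
  have h4 := norm_harmonic_le (k + 1)
  push_cast at h4
  nlinarith

lemma hasDerivAt_besselSeries (w : ℂ) : HasDerivAt besselSeries (besselSeriesDeriv w) w := by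
  refine (hasDerivAt_tsum_mul_pow norm_besselSeries_coeff_le w).congr_deriv ?_
  refine tsum_congr fun k => ?_
  have := k.factorial_ne_zero
  have : (k : ℂ) + 1 ≠ 0 := by exact_mod_cast k.succ_ne_zero
  rw [Nat.factorial_succ]; push_cast; field_simp

lemma hasDerivAt_harmonicSeries (w : ℂ) : HasDerivAt harmonicSeries (harmonicSeriesDeriv w) w := by
  refine (hasDerivAt_tsum_mul_pow norm_harmonicSeries_coeff_le w).congr_deriv ?_
  refine tsum_congr fun k => ?_
  have := k.factorial_ne_zero
  have : (k : ℂ) + 1 ≠ 0 := by exact_mod_cast k.succ_ne_zero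
  rw [Nat.factorial_succ]; push_cast; field_simp

/-- The Bessel equation `(w A')' = A`. -/
lemma hasDerivAt_mul_besselSeriesDeriv (w : ℂ) :
    HasDerivAt (fun w => w * besselSeriesDeriv w) (besselSeries w) w := by
  refine (hasDerivAt_mul_tsum_mul_pow norm_besselSeriesDeriv_coeff_le w).congr_deriv ?_
  refine tsum_congr fun k => ?_
  have := k.factorial_ne_zero
  have : (k : ℂ) + 1 ≠ 0 := by exact_mod_cast k.succ_ne_zero
  rw [Nat.factorial_succ]; push_cast; field_simp

/-- The equation `(w B')' = B + A'`, which makes `-A log w + 2 B` a second solution of the Bessel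
equation `(w u')' = u`. -/
lemma hasDerivAt_mul_harmonicSeriesDeriv (w : ℂ) :
    HasDerivAt (fun w => w * harmonicSeriesDeriv w) (harmonicSeries w + besselSeriesDeriv w) w := by
  refine (hasDerivAt_mul_tsum_mul_pow norm_harmonicSeriesDeriv_coeff_le w).congr_deriv ?_
  rw [harmonicSeries, besselSeriesDeriv, ← Summable.tsum_add
    (summable_norm_mul_pow_of_le_div_factorial norm_harmonicSeries_coeff_le w)
    (summable_norm_mul_pow_of_le_div_factorial (K := 1) (fun k =>
      (norm_besselSeriesDeriv_coeff_le k).trans (by gcongr; omega)) w)]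
  refine tsum_congr fun k => ?_
  have := k.factorial_ne_zero
  have : (k : ℂ) + 1 ≠ 0 := by exact_mod_cast k.succ_ne_zero
  rw [harmonic_succ, Nat.factorial_succ]; push_cast; field_simp

lemma continuous_besselSeries : Continuous besselSeries :=
  continuous_iff_continuousAt.2 fun w => (hasDerivAt_besselSeries w).continuousAt

lemma continuous_harmonicSeries : Continuous harmonicSeries :=
  continuous_iff_continuousAt.2 fun w => (hasDerivAt_harmonicSeries w).continuousAt

lemma besselSeries_zero : besselSeries 0 = 1 := by
  rw [besselSeries, tsum_eq_single 0 fun k hk => by simp [hk]]; simp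

lemma harmonicSeries_zero : harmonicSeries 0 = 0 := by
  rw [harmonicSeries, tsum_eq_single 0 fun k hk => by simp [hk]]; simp

open MeasureTheory Set Filter

/-! ### Improper integrals on the half-line -/

/-- The fundamental theorem of calculus on `(0, ∞)` for a function that vanishes at both ends; at
infinity this is automatic from integrability. -/
lemma integral_Ioi_deriv_eq_zero {f f' : ℝ → ℂ} (hderiv : ∀ t ∈ Ioi (0 : ℝ), HasDerivAt f (f' t) t)
    (hf : IntegrableOn f (Ioi 0)) (hf' : IntegrableOn f' (Ioi 0))
    (h0 : Tendsto f (𝓝[>] 0) (𝓝 0)) : ∫ t in Ioi (0 : ℝ), f' t = 0 := by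
  have h := integral_Ioi_deriv_mul_eq_sub (u := fun _ => (1 : ℂ)) (u' := fun _ => 0) (v := f)
    (v' := f') (a' := 0) (b' := 0) (fun x _ => hasDerivAt_const x _) hderiv
    (by simpa [Pi.mul_def, Pi.add_def] using hf') (by simpa [Pi.mul_def] using h0)
    (by simpa [Pi.mul_def] using tendsto_zero_of_hasDerivAt_of_integrableOn_Ioi hderiv hf' hf)
  simpa using h

/-- The substitution `t ↦ r / t`. -/
lemma integral_Ioi_comp_div {r : ℝ} (hr : 0 < r) (f : ℝ → ℂ) :
    ∫ t in Ioi (0 : ℝ), (r / t ^ 2 : ℝ) • f (r / t) = ∫ t in Ioi (0 : ℝ), f t := by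
  have himg : (fun t : ℝ => r / t) '' Ioi 0 = Ioi 0 := by
    ext t
    simp only [mem_image, mem_Ioi]
    exact ⟨fun ⟨s, hs, h⟩ => h ▸ by positivity,
      fun ht => ⟨r / t, by positivity, by field_simp⟩⟩
  have h := integral_image_eq_integral_abs_deriv_smul (s := Ioi (0 : ℝ)) (f := fun t => r / t)
    (f' := fun t => -(r / t ^ 2)) measurableSet_Ioi (fun t ht => ?_) (fun s hs t ht hst => ?_) f
  · rw [himg] at h
    rw [h]
    refine setIntegral_congr_fun measurableSet_Ioi fun t ht => ?_
    simp only [abs_neg]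
    rw [abs_of_nonneg (by positivity)]
  · have : (t : ℝ) ≠ 0 := (mem_Ioi.1 ht).ne'
    have := ((hasDerivAt_inv this).const_mul r).hasDerivWithinAt (s := Ioi 0)
    simpa [div_eq_mul_inv] using this
  · have hs' : s ≠ 0 := (mem_Ioi.1 hs).ne'
    have ht' : t ≠ 0 := (mem_Ioi.1 ht).ne'
    have : r / s = r / t := hst
    field_simp at this
    exact this.symm

lemma abs_log_le {t : ℝ} (ht : 0 < t) : |Real.log t| ≤ t + 2 * t ^ (-(1 / 2) : ℝ) := by
  have h1 := Real.log_le_self ht.le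
  have h2 := Real.log_le_rpow_div (inv_nonneg.2 ht.le) (ε := 1 / 2) (by norm_num)
  rw [Real.log_inv, Real.inv_rpow ht.le, ← Real.rpow_neg ht.le] at h2
  have h3 : 0 ≤ t ^ (-(1 / 2) : ℝ) := by positivity
  rw [abs_le]
  constructor <;> linarith

lemma integrableOn_rpow_mul_exp {s α : ℝ} (hs : -1 < s) (hα : 0 < α) :
    IntegrableOn (fun t : ℝ => t ^ s * Real.exp (-α * t)) (Ioi 0) := by
  simpa using integrableOn_rpow_mul_exp_neg_mul_rpow hs one_pos hα

lemma integrableOn_rpow_mul_abs_log_mul_exp {s α : ℝ} (hs : 0 ≤ s) (hα : 0 < α) :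
    IntegrableOn (fun t : ℝ => t ^ s * |Real.log t| * Real.exp (-α * t)) (Ioi 0) := by
  refine ((integrableOn_rpow_mul_exp (s := s + 1) (by linarith) hα).add
    ((integrableOn_rpow_mul_exp (s := s - 1 / 2) (by linarith) hα).const_mul 2)).mono'
    (by fun_prop) ?_
  refine (ae_restrict_iff' measurableSet_Ioi).2 (ae_of_all _ fun t (ht : 0 < t) => ?_)
  have h := abs_log_le ht
  rw [Real.norm_of_nonneg (by positivity)]
  simp only [Pi.add_apply]
  calc t ^ s * |Real.log t| * Real.exp (-α * t)
      ≤ t ^ s * (t + 2 * t ^ (-(1 / 2) : ℝ)) * Real.exp (-α * t) := by gcongr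
    _ = _ := by
      rw [Real.rpow_add ht, Real.rpow_sub ht, Real.rpow_one, Real.rpow_neg ht.le]
      ring

lemma integrableOn_exp_neg {α : ℝ} (hα : 0 < α) :
    IntegrableOn (fun t : ℝ => Real.exp (-α * t)) (Ioi 0) := by
  simpa using integrableOn_rpow_mul_exp (s := 0) (by norm_num) hα

lemma integrableOn_abs_log_mul_exp {α : ℝ} (hα : 0 < α) :
    IntegrableOn (fun t : ℝ => |Real.log t| * Real.exp (-α * t)) (Ioi 0) := by
  simpa using integrableOn_rpow_mul_abs_log_mul_exp le_rfl hα

/-! ### The logarithmic Laplace integral -/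

lemma norm_cexp_neg_mul (a : ℂ) (t : ℝ) : ‖Complex.exp (-a * t)‖ = Real.exp (-a.re * t) := by
  rw [Complex.norm_exp]; simp

lemma integrableOn_log_mul_cexp {a : ℂ} (ha : 0 < a.re) :
    IntegrableOn (fun t : ℝ => (Real.log t : ℂ) * Complex.exp (-a * t)) (Ioi 0) := by
  refine (integrableOn_abs_log_mul_exp ha).mono' (by fun_prop) (ae_of_all _ fun t => ?_)
  rw [norm_mul, norm_cexp_neg_mul, Complex.norm_real, Real.norm_eq_abs]

lemma integrableOn_mul_log_mul_cexp {a : ℂ} (ha : 0 < a.re) :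
    IntegrableOn (fun t : ℝ => (t : ℂ) * Real.log t * Complex.exp (-a * t)) (Ioi 0) := by
  refine (integrableOn_rpow_mul_abs_log_mul_exp zero_le_one ha).mono' (by fun_prop) ?_
  refine (ae_restrict_iff' measurableSet_Ioi).2 (ae_of_all _ fun t (ht : 0 < t) => ?_)
  rw [norm_mul, norm_mul, norm_cexp_neg_mul, Complex.norm_real, Complex.norm_real, Real.rpow_one,
    Real.norm_of_nonneg ht.le, Real.norm_eq_abs]

lemma integrableOn_cexp {a : ℂ} (ha : 0 < a.re) :
    IntegrableOn (fun t : ℝ => Complex.exp (-a * t)) (Ioi 0) := by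
  refine (integrableOn_exp_neg ha).mono' (by fun_prop) (ae_of_all _ fun t => ?_)
  rw [norm_cexp_neg_mul]

lemma integral_cexp_neg_mul {a : ℂ} (ha : 0 < a.re) :
    ∫ t in Ioi (0 : ℝ), Complex.exp (-a * t) = 1 / a := by
  rw [integral_exp_mul_complex_Ioi (by simpa using ha)]; simp

lemma hasDerivAt_cexp_neg_mul (a : ℂ) (t : ℝ) :
    HasDerivAt (fun t : ℝ => Complex.exp (-a * t)) (-a * Complex.exp (-a * t)) t := by
  have h := ((hasDerivAt_id (t : ℂ)).const_mul (-a)).cexp.comp_ofReal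
  refine h.congr_deriv ?_
  simp; ring

lemma hasDerivAt_ofReal_log {t : ℝ} (ht : 0 < t) :
    HasDerivAt (fun t : ℝ => (Real.log t : ℂ)) ((t : ℂ)⁻¹) t := by
  simpa using (Real.hasDerivAt_log ht.ne').ofReal_comp

/-- Integration of the derivative of `t log t · e^{-at}`. -/
lemma integral_log_mul_cexp_parts {a : ℂ} (ha : 0 < a.re) :
    (∫ t in Ioi (0 : ℝ), (Real.log t : ℂ) * Complex.exp (-a * t)) -
      a * (∫ t in Ioi (0 : ℝ), (t : ℂ) * Real.log t * Complex.exp (-a * t)) + 1 / a = 0 := by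
  have h := integral_Ioi_deriv_eq_zero
    (f := fun t : ℝ => (t : ℂ) * Real.log t * Complex.exp (-a * t))
    (f' := fun t : ℝ => (Real.log t : ℂ) * Complex.exp (-a * t)
      - a * ((t : ℂ) * Real.log t * Complex.exp (-a * t)) + Complex.exp (-a * t))
    (fun t ht => ?_) (integrableOn_mul_log_mul_cexp ha)
    (((integrableOn_log_mul_cexp ha).sub ((integrableOn_mul_log_mul_cexp ha).const_mul a)).add
      (integrableOn_cexp ha)) ?_
  · rw [integral_add _ (integrableOn_cexp ha), integral_sub (integrableOn_log_mul_cexp ha)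
      ((integrableOn_mul_log_mul_cexp ha).const_mul a), integral_const_mul,
      integral_cexp_neg_mul ha] at h
    · exact h
    · exact (integrableOn_log_mul_cexp ha).sub ((integrableOn_mul_log_mul_cexp ha).const_mul a)
  · have ht' : (t : ℂ) ≠ 0 := by exact_mod_cast (mem_Ioi.1 ht).ne'
    have h := (((hasDerivAt_id (t : ℂ)).comp_ofReal).mul (hasDerivAt_ofReal_log ht)).mul
      (hasDerivAt_cexp_neg_mul a t)
    refine h.congr_deriv ?_
    simp only [id_eq, Pi.mul_apply]
    field_simp
    ring
  · have h1 : Tendsto (fun t : ℝ => ((Real.log t * t ^ (1 : ℝ) : ℝ) : ℂ)) (𝓝[>] 0) (𝓝 0) := 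
      (Complex.continuous_ofReal.tendsto' 0 0 rfl).comp (tendsto_log_mul_rpow_nhdsGT_zero one_pos)
    have h2 : Tendsto (fun t : ℝ => Complex.exp (-a * t)) (𝓝[>] 0)
        (𝓝 (Complex.exp (-a * (0 : ℝ)))) :=
      tendsto_nhdsWithin_of_tendsto_nhds (Continuous.tendsto (by fun_prop) 0)
    have := h1.mul h2
    rw [zero_mul] at this
    refine this.congr fun t => ?_
    rw [Real.rpow_one]; push_cast; ring

lemma hasDerivAt_integral_log_mul_cexp {a : ℂ} (ha : 0 < a.re) :
    HasDerivAt (fun a : ℂ => ∫ t in Ioi (0 : ℝ), (Real.log t : ℂ) * Complex.exp (-a * t))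
      (-∫ t in Ioi (0 : ℝ), (t : ℂ) * Real.log t * Complex.exp (-a * t)) a := by
  rw [← integral_neg]
  refine (hasDerivAt_integral_of_dominated_loc_of_deriv_le (s := {z : ℂ | a.re / 2 < z.re})
    (F := fun (z : ℂ) (t : ℝ) => (Real.log t : ℂ) * Complex.exp (-z * t))
    (F' := fun (z : ℂ) (t : ℝ) => -((t : ℂ) * Real.log t * Complex.exp (-z * t)))
    (bound := fun t : ℝ => t ^ (1 : ℝ) * |Real.log t| * Real.exp (-(a.re / 2) * t))
    ((isOpen_lt continuous_const Complex.continuous_re).mem_nhds (by simp; linarith))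
    (Eventually.of_forall fun z => by fun_prop) (integrableOn_log_mul_cexp ha) (by fun_prop) ?_
    (integrableOn_rpow_mul_abs_log_mul_exp zero_le_one (by linarith)) ?_).2
  · refine (ae_restrict_iff' measurableSet_Ioi).2 (ae_of_all _ fun t (ht : 0 < t) z hz => ?_)
    rw [norm_neg, norm_mul, norm_mul, norm_cexp_neg_mul, Complex.norm_real, Complex.norm_real,
      Real.rpow_one, Real.norm_of_nonneg ht.le, Real.norm_eq_abs]
    have : a.re / 2 ≤ z.re := le_of_lt hz
    gcongr
  · refine ae_of_all _ fun t z _ => ?_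
    have h := ((((hasDerivAt_id z).neg).mul_const (t : ℂ)).cexp).const_mul (Real.log t : ℂ)
    refine h.congr_deriv ?_
    simp; ring

lemma integral_log_mul_cexp_neg :
    ∫ t in Ioi (0 : ℝ), (Real.log t : ℂ) * Complex.exp (-(1 : ℂ) * t) =
      -Real.eulerMascheroniConstant := by
  have h1 := Complex.hasDerivAt_GammaIntegral (s := 1) (by simp)
  have h2 : HasDerivAt Complex.GammaIntegral (-(Real.eulerMascheroniConstant : ℂ)) 1 := by
    refine Complex.hasDerivAt_Gamma_one.congr_of_eventuallyEq ?_
    filter_upwards [(isOpen_lt continuous_const Complex.continuous_re).mem_nhds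
      (show (0 : ℝ) < (1 : ℂ).re by simp)] with s hs
    exact (Complex.Gamma_eq_integral hs).symm
  rw [← h1.unique h2]
  refine setIntegral_congr_fun measurableSet_Ioi fun t ht => ?_
  simp

/-- `a ∫₀^∞ log t · e^{-at} dt + log a` has vanishing derivative on the right half-plane, and equals
`Γ'(1) = -γ` at `a = 1`. -/
lemma mul_integral_log_mul_cexp {a : ℂ} (ha : 0 < a.re) :
    a * ∫ t in Ioi (0 : ℝ), (Real.log t : ℂ) * Complex.exp (-a * t) =
      -Real.eulerMascheroniConstant - Complex.log a := by
  set S : Set ℂ := {z | 0 < z.re}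
  have hd : ∀ z ∈ S, HasDerivAt (fun a : ℂ => a * (∫ t in Ioi (0 : ℝ),
      (Real.log t : ℂ) * Complex.exp (-a * t)) + Complex.log a) 0 z := fun z hz => by
    have h := ((hasDerivAt_id z).mul (hasDerivAt_integral_log_mul_cexp hz)).add
      (Complex.hasDerivAt_log (Or.inl hz))
    refine h.congr_deriv ?_
    rw [← integral_log_mul_cexp_parts hz]
    simp only [id_eq]
    ring
  have h := IsOpen.is_const_of_deriv_eq_zero (𝕜 := ℂ) (s := S)
    (isOpen_lt continuous_const Complex.continuous_re)
    (convex_halfSpace_re_gt 0).isPreconnected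
    (fun z hz => (hd z hz).differentiableAt.differentiableWithinAt) (fun z hz => (hd z hz).deriv)
    (x := a) (y := 1) ha (by simp [S])
  simp only [integral_log_mul_cexp_neg, Complex.log_one, one_mul, add_zero] at h
  rw [← h]; ring

/-! ### The Macdonald integral -/

/-- The weight `e^{-at - b/t}` of the Macdonald integral. -/
def macdonaldWeight (a b : ℂ) (t : ℝ) : ℂ := Complex.exp (-a * t - b / t)

/-- The integral `∫₀^∞ e^{-at - b/t} dt/t = 2 K₀(2 √(ab))`, absolutely convergent when `a` and `b`
lie in the open right half-plane. -/
def macdonaldIntegral (a b : ℂ) : ℂ := ∫ t in Ioi (0 : ℝ), macdonaldWeight a b t / t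

@[fun_prop]
lemma measurable_macdonaldWeight (a b : ℂ) : Measurable (macdonaldWeight a b) := by
  unfold macdonaldWeight; fun_prop

lemma norm_macdonaldWeight (a b : ℂ) (t : ℝ) :
    ‖macdonaldWeight a b t‖ = Real.exp (-a.re * t) * Real.exp (-(b.re / t)) := by
  rw [macdonaldWeight, Complex.norm_exp, ← Real.exp_add]
  simp [Complex.div_ofReal_re, sub_eq_add_neg]

lemma exp_neg_div_le {β t : ℝ} (hβ : 0 < β) (ht : 0 < t) (n : ℕ) :
    Real.exp (-(β / t)) / t ^ n ≤ n.factorial / β ^ n := by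
  have h := Real.pow_div_factorial_le_exp (β / t) (by positivity) n
  rw [Real.exp_neg, div_le_div_iff₀ (by positivity) (by positivity)]
  rw [div_pow, div_div, div_le_iff₀ (by positivity)] at h
  rw [inv_mul_le_iff₀ (by positivity)]
  linarith

lemma norm_macdonaldWeight_le (a : ℂ) {b : ℂ} (hb : 0 ≤ b.re) {t : ℝ} (ht : 0 < t) :
    ‖macdonaldWeight a b t‖ ≤ Real.exp (-a.re * t) := by
  rw [norm_macdonaldWeight]
  exact mul_le_of_le_one_right (by positivity) (Real.exp_le_one_iff.2 (by
    have := div_nonneg hb ht.le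
    linarith))

lemma norm_macdonaldWeight_div_pow_le (a : ℂ) {b : ℂ} (hb : 0 < b.re) {t : ℝ} (ht : 0 < t) (n : ℕ) :
    ‖macdonaldWeight a b t / (t : ℂ) ^ n‖ ≤ n.factorial / b.re ^ n * Real.exp (-a.re * t) := by
  rw [norm_div, norm_macdonaldWeight, norm_pow, Complex.norm_real, Real.norm_of_nonneg ht.le]
  calc _ = Real.exp (-(b.re / t)) / t ^ n * Real.exp (-a.re * t) := by ring
    _ ≤ _ := mul_le_mul_of_nonneg_right (exp_neg_div_le hb ht n) (Real.exp_pos _).le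

lemma integrableOn_macdonaldWeight_div_pow {a b : ℂ} (ha : 0 < a.re) (hb : 0 < b.re) (n : ℕ) :
    IntegrableOn (fun t : ℝ => macdonaldWeight a b t / (t : ℂ) ^ n) (Ioi 0) := by
  refine ((integrableOn_exp_neg ha).const_mul (n.factorial / b.re ^ n)).mono'
    (Measurable.aestronglyMeasurable (by fun_prop)) ?_
  exact (ae_restrict_iff' measurableSet_Ioi).2 (ae_of_all _ fun t (ht : 0 < t) =>
    norm_macdonaldWeight_div_pow_le a hb ht n)

lemma integrableOn_macdonaldWeight {a b : ℂ} (ha : 0 < a.re) (hb : 0 < b.re) :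
    IntegrableOn (macdonaldWeight a b) (Ioi 0) := by
  simpa using integrableOn_macdonaldWeight_div_pow ha hb 0

lemma integrableOn_macdonaldWeight_div {a b : ℂ} (ha : 0 < a.re) (hb : 0 < b.re) :
    IntegrableOn (fun t : ℝ => macdonaldWeight a b t / t) (Ioi 0) := by
  simpa using integrableOn_macdonaldWeight_div_pow ha hb 1

lemma integrableOn_log_mul_macdonaldWeight_div_pow {a b : ℂ} (ha : 0 < a.re) (hb : 0 < b.re)
    (n : ℕ) :
    IntegrableOn (fun t : ℝ => (Real.log t : ℂ) * (macdonaldWeight a b t / (t : ℂ) ^ n))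
      (Ioi 0) := by
  refine ((integrableOn_abs_log_mul_exp ha).const_mul (n.factorial / b.re ^ n)).mono'
    (Measurable.aestronglyMeasurable (by fun_prop)) ?_
  refine (ae_restrict_iff' measurableSet_Ioi).2 (ae_of_all _ fun t (ht : 0 < t) => ?_)
  rw [norm_mul, Complex.norm_real, Real.norm_eq_abs]
  calc _ ≤ |Real.log t| * (n.factorial / b.re ^ n * Real.exp (-a.re * t)) := by
        gcongr; exact norm_macdonaldWeight_div_pow_le a hb ht n
    _ = _ := by ring

lemma integrableOn_log_mul_macdonaldWeight {a b : ℂ} (ha : 0 < a.re) (hb : 0 < b.re) :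
    IntegrableOn (fun t : ℝ => (Real.log t : ℂ) * macdonaldWeight a b t) (Ioi 0) := by
  simpa using integrableOn_log_mul_macdonaldWeight_div_pow ha hb 0

lemma hasDerivAt_macdonaldWeight (a b : ℂ) {t : ℝ} (ht : 0 < t) :
    HasDerivAt (macdonaldWeight a b)
      (b * (macdonaldWeight a b t / (t : ℂ) ^ 2) - a * macdonaldWeight a b t) t := by
  have ht' : (t : ℂ) ≠ 0 := by exact_mod_cast ht.ne'
  have h := (((hasDerivAt_id (t : ℂ)).const_mul (-a)).sub
    ((hasDerivAt_inv ht').const_mul b)).cexp.comp_ofReal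
  refine (h.congr_of_eventuallyEq ?_).congr_deriv ?_
  · exact Eventually.of_forall fun t => by simp [macdonaldWeight, div_eq_mul_inv]
  · simp only [macdonaldWeight, id_eq, Pi.sub_apply, div_eq_mul_inv]; ring

lemma tendsto_macdonaldWeight_zero {a b : ℂ} (ha : 0 < a.re) (hb : 0 < b.re) :
    Tendsto (fun t : ℝ => macdonaldWeight a b t / t) (𝓝[>] 0) (𝓝 0) := by
  have h1 : Tendsto (fun t : ℝ => 2 / b.re ^ 2 * t) (𝓝[>] 0) (𝓝 0) :=
    tendsto_nhdsWithin_of_tendsto_nhds (Continuous.tendsto' (by fun_prop) 0 0 (by simp))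
  refine squeeze_zero_norm' ?_ h1
  filter_upwards [self_mem_nhdsWithin] with t (ht : 0 < t)
  have h := norm_macdonaldWeight_div_pow_le a hb ht 2
  have hexp : Real.exp (-a.re * t) ≤ 1 := Real.exp_le_one_iff.2 (by nlinarith)
  have : macdonaldWeight a b t / t = macdonaldWeight a b t / (t : ℂ) ^ 2 * t := by
    have ht' : (t : ℂ) ≠ 0 := by exact_mod_cast ht.ne'
    field_simp
  rw [this, norm_mul, Complex.norm_real, Real.norm_of_nonneg ht.le]
  gcongr
  refine h.trans ?_
  simpa using mul_le_of_le_one_right (by positivity : (0 : ℝ) ≤ 2 / b.re ^ 2) hexp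

/-- Integration of the derivative of the weight. -/
lemma integral_macdonaldWeight_parts {a b : ℂ} (ha : 0 < a.re) (hb : 0 < b.re) :
    b * (∫ t in Ioi (0 : ℝ), macdonaldWeight a b t / (t : ℂ) ^ 2) =
      a * ∫ t in Ioi (0 : ℝ), macdonaldWeight a b t := by
  have i1 := integrableOn_macdonaldWeight_div_pow ha hb 2
  have i2 := integrableOn_macdonaldWeight ha hb
  have h := integral_Ioi_deriv_eq_zero (fun t ht => hasDerivAt_macdonaldWeight a b ht) i2
    ((i1.const_mul b).sub (i2.const_mul a)) ?_
  · rw [integral_sub (i1.const_mul b) (i2.const_mul a), integral_const_mul,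
      integral_const_mul] at h
    exact sub_eq_zero.1 h
  · have h1 : Tendsto (fun t : ℝ => (t : ℂ)) (𝓝[>] 0) (𝓝 0) :=
      tendsto_nhdsWithin_of_tendsto_nhds (Continuous.tendsto' (by fun_prop) 0 0 (by simp))
    have := (tendsto_macdonaldWeight_zero ha hb).mul h1
    rw [zero_mul] at this
    refine this.congr' ?_
    filter_upwards [self_mem_nhdsWithin] with t (ht : 0 < t)
    have ht' : (t : ℂ) ≠ 0 := by exact_mod_cast ht.ne'
    field_simp

/-- Integration by parts against `log t`. -/
lemma macdonaldIntegral_eq_integral_log {a b : ℂ} (ha : 0 < a.re) (hb : 0 < b.re) :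
    macdonaldIntegral a b = a * (∫ t in Ioi (0 : ℝ), (Real.log t : ℂ) * macdonaldWeight a b t) -
      b * ∫ t in Ioi (0 : ℝ), (Real.log t : ℂ) * (macdonaldWeight a b t / (t : ℂ) ^ 2) := by
  have i0 := integrableOn_macdonaldWeight_div ha hb
  have i1 := (integrableOn_log_mul_macdonaldWeight_div_pow ha hb 2).const_mul b
  have i2 := (integrableOn_log_mul_macdonaldWeight ha hb).const_mul a
  have h := integral_Ioi_deriv_eq_zero
    (f := fun t : ℝ => (Real.log t : ℂ) * macdonaldWeight a b t)
    (f' := fun t : ℝ => macdonaldWeight a b t / t +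
      (b * ((Real.log t : ℂ) * (macdonaldWeight a b t / (t : ℂ) ^ 2)) -
        a * ((Real.log t : ℂ) * macdonaldWeight a b t))) (fun t ht => ?_)
    (integrableOn_log_mul_macdonaldWeight ha hb) (i0.add (i1.sub i2)) ?_
  · rw [integral_add i0 (by exact i1.sub i2), integral_sub i1 i2, integral_const_mul,
      integral_const_mul] at h
    rw [macdonaldIntegral]
    linear_combination h
  · refine ((hasDerivAt_ofReal_log ht).mul (hasDerivAt_macdonaldWeight a b ht)).congr_deriv ?_
    ring
  · have h1 : Tendsto (fun t : ℝ => ((Real.log t * t ^ (1 : ℝ) : ℝ) : ℂ)) (𝓝[>] 0) (𝓝 0) :=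
      (Complex.continuous_ofReal.tendsto' 0 0 rfl).comp (tendsto_log_mul_rpow_nhdsGT_zero one_pos)
    have := h1.mul (tendsto_macdonaldWeight_zero ha hb)
    rw [zero_mul] at this
    refine this.congr' ?_
    filter_upwards [self_mem_nhdsWithin] with t (ht : 0 < t)
    have ht' : (t : ℂ) ≠ 0 := by exact_mod_cast ht.ne'
    rw [Real.rpow_one]; push_cast; field_simp

lemma macdonaldWeight_comp_div {a b : ℂ} {r t : ℝ} (hr : 0 < r) (ht : 0 < t) :
    macdonaldWeight a (r * b) (r / t) = macdonaldWeight b (r * a) t := by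
  have ht' : (t : ℂ) ≠ 0 := by exact_mod_cast ht.ne'
  have hr' : (r : ℂ) ≠ 0 := by exact_mod_cast hr.ne'
  rw [macdonaldWeight, macdonaldWeight]
  congr 1
  push_cast
  field_simp
  ring

lemma re_ofReal_mul_pos {r : ℝ} (hr : 0 < r) {b : ℂ} (hb : 0 < b.re) : 0 < ((r : ℂ) * b).re := by
  simpa using mul_pos hr hb

lemma integral_log_mul_macdonaldWeight_div_sq {a b : ℂ} (ha : 0 < a.re) (hb : 0 < b.re) {r : ℝ}
    (hr : 0 < r) :
    r * (∫ t in Ioi (0 : ℝ), (Real.log t : ℂ) * (macdonaldWeight a (r * b) t / (t : ℂ) ^ 2)) =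
      Real.log r * (∫ t in Ioi (0 : ℝ), macdonaldWeight b (r * a) t) -
        ∫ t in Ioi (0 : ℝ), (Real.log t : ℂ) * macdonaldWeight b (r * a) t := by
  have hra := re_ofReal_mul_pos hr ha
  rw [← integral_Ioi_comp_div hr, ← integral_const_mul, ← integral_const_mul, ← integral_sub
    ((integrableOn_macdonaldWeight hb hra).const_mul _)
    (integrableOn_log_mul_macdonaldWeight hb hra)]
  refine setIntegral_congr_fun measurableSet_Ioi fun t (ht : 0 < t) => ?_
  have ht' : (t : ℂ) ≠ 0 := by exact_mod_cast ht.ne'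
  have hr' : (r : ℂ) ≠ 0 := by exact_mod_cast hr.ne'
  simp only [macdonaldWeight_comp_div hr ht, Real.log_div hr.ne' ht.ne', Complex.real_smul]
  push_cast
  field_simp

/-- Splitting off the logarithm: after integration by parts the part of the integral where `t` is of
order `r` is rescaled by `t ↦ r / t`. -/
lemma macdonaldIntegral_ofReal_mul {a b : ℂ} (ha : 0 < a.re) (hb : 0 < b.re) {r : ℝ} (hr : 0 < r) :
    macdonaldIntegral a (r * b) =
      a * (∫ t in Ioi (0 : ℝ), (Real.log t : ℂ) * macdonaldWeight a (r * b) t) +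
      b * (∫ t in Ioi (0 : ℝ), (Real.log t : ℂ) * macdonaldWeight b (r * a) t) -
      Real.log r * (b * ∫ t in Ioi (0 : ℝ), macdonaldWeight b (r * a) t) := by
  rw [macdonaldIntegral_eq_integral_log ha (re_ofReal_mul_pos hr hb)]
  linear_combination -b * integral_log_mul_macdonaldWeight_div_sq ha hb hr

lemma hasDerivAt_integral_macdonaldWeight {a b : ℂ} (ha : 0 < a.re) (hb : 0 < b.re) {r : ℝ}
    (hr : 0 < r) (n : ℕ) :
    HasDerivAt (fun r : ℝ => ∫ t in Ioi (0 : ℝ), macdonaldWeight a (r * b) t / (t : ℂ) ^ n)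
      (-b * ∫ t in Ioi (0 : ℝ), macdonaldWeight a (r * b) t / (t : ℂ) ^ (n + 1)) r := by
  rw [← integral_const_mul]
  refine (hasDerivAt_integral_of_dominated_loc_of_deriv_le (s := Ioi (r / 2))
    (F := fun (r : ℝ) (t : ℝ) => macdonaldWeight a (r * b) t / (t : ℂ) ^ n)
    (F' := fun (r : ℝ) (t : ℝ) => -b * (macdonaldWeight a (r * b) t / (t : ℂ) ^ (n + 1)))
    (bound := fun t : ℝ => ‖b‖ * ((n + 1).factorial / (r / 2 * b.re) ^ (n + 1) *
      Real.exp (-a.re * t))) (Ioi_mem_nhds (by linarith))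
    (Eventually.of_forall fun z => Measurable.aestronglyMeasurable (by fun_prop))
    (integrableOn_macdonaldWeight_div_pow ha (re_ofReal_mul_pos hr hb) n)
    (Measurable.aestronglyMeasurable (by fun_prop)) ?_
    (((integrableOn_exp_neg ha).const_mul _).const_mul _) ?_).2
  · refine (ae_restrict_iff' measurableSet_Ioi).2 (ae_of_all _ fun t (ht : 0 < t) x hx => ?_)
    have hx0 : 0 < x := lt_trans (by linarith) hx
    rw [norm_mul, norm_neg]
    gcongr
    refine (norm_macdonaldWeight_div_pow_le a (re_ofReal_mul_pos hx0 hb) ht (n + 1)).trans ?_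
    have : r / 2 * b.re ≤ ((x : ℂ) * b).re := by
      rw [Complex.re_ofReal_mul]
      exact mul_le_mul_of_nonneg_right (le_of_lt hx) hb.le
    gcongr
  · refine (ae_restrict_iff' measurableSet_Ioi).2 (ae_of_all _ fun t (ht : 0 < t) x _ => ?_)
    have ht' : (t : ℂ) ≠ 0 := by exact_mod_cast ht.ne'
    have h := ((((((hasDerivAt_id (x : ℂ)).mul_const b).div_const (t : ℂ)).const_sub
      (-a * t)).cexp).div_const ((t : ℂ) ^ n)).comp_ofReal
    refine h.congr_deriv ?_
    simp only [macdonaldWeight, id_eq]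
    field_simp
    ring

/-! ### Identification of the Macdonald integral with the Bessel series -/

lemma norm_le_of_norm_deriv_le_pow {f f' : ℝ → ℂ} {K X : ℝ} {n : ℕ}
    (hf : ∀ x > 0, HasDerivAt f (f' x) x) (h0 : Tendsto f (𝓝[>] 0) (𝓝 0))
    (hb : ∀ x ∈ Ioc 0 X, ‖f' x‖ ≤ K * x ^ n) :
    ∀ x ∈ Ioc 0 X, ‖f x‖ ≤ K * x ^ (n + 1) / (n + 1) := by
  intro x hx
  have key : ∀ d ∈ Ioc 0 x, ‖f x‖ ≤ ‖f d‖ + K * (x ^ (n + 1) - d ^ (n + 1)) / (n + 1) := by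
    intro d hd
    have hn : (n : ℝ) + 1 ≠ 0 := by positivity
    refine image_norm_le_of_norm_deriv_right_le_deriv_boundary (f := f) (f' := f') (a := d) (b := x)
      (B := fun y => ‖f d‖ + K * (y ^ (n + 1) - d ^ (n + 1)) / (n + 1)) (B' := fun y => K * y ^ n)
      (fun y hy => (hf y (hd.1.trans_le hy.1)).continuousAt.continuousWithinAt)
      (fun y hy => (hf y (hd.1.trans_le hy.1)).hasDerivWithinAt) (by simp) (fun y => ?_)
      (fun y hy => hb y ⟨hd.1.trans_le hy.1, hy.2.le.trans hx.2⟩) ⟨hd.2, le_rfl⟩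
    have h := ((((hasDerivAt_pow (n + 1) y).sub_const (d ^ (n + 1))).const_mul K).div_const
      ((n : ℝ) + 1)).const_add ‖f d‖
    refine h.congr_deriv ?_
    simp only [Nat.add_sub_cancel]; push_cast; field_simp
  have hlim : Tendsto (fun d : ℝ => ‖f d‖ + K * (x ^ (n + 1) - d ^ (n + 1)) / (n + 1)) (𝓝[>] 0)
      (𝓝 (‖(0 : ℂ)‖ + K * (x ^ (n + 1) - 0 ^ (n + 1)) / (n + 1))) := by
    refine h0.norm.add (tendsto_nhdsWithin_of_tendsto_nhds (Continuous.tendsto' ?_ 0 _ rfl))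
    fun_prop
  have := ge_of_tendsto hlim (by
    filter_upwards [Ioc_mem_nhdsGT hx.1] with d hd using key d hd)
  simpa using this

/-- If `D' = V / x` and `V' = q D` on `(0, ∞)`, and `D` and `V` vanish at `0`, then `D = 0`: by
induction, `|D| ≤ M (|q| x)ⁿ / n!` for every `n`. -/
lemma eq_zero_of_singular_system {D V : ℝ → ℂ} {q : ℂ} (hD : ∀ x > 0, HasDerivAt D (V x / x) x)
    (hV : ∀ x > 0, HasDerivAt V (q * D x) x) (hD0 : Tendsto D (𝓝[>] 0) (𝓝 0))
    (hV0 : Tendsto V (𝓝[>] 0) (𝓝 0)) {X : ℝ} (hX : 0 < X) : D X = 0 := by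
  obtain ⟨M, hM⟩ : ∃ M, ∀ x ∈ Ioc 0 X, ‖D x‖ ≤ M := by
    have h1 : ∀ᶠ x in 𝓝[>] 0, ‖D x‖ < 1 := by
      have := hD0.norm
      rw [norm_zero] at this
      exact this.eventually_lt_const one_pos
    obtain ⟨d, hd, hdD⟩ := mem_nhdsGT_iff_exists_Ioo_subset.1 h1
    obtain ⟨M, hM⟩ := isCompact_Icc.exists_bound_of_continuousOn (s := Icc d X) (f := D)
      (fun y hy => (hD y (lt_of_lt_of_le hd hy.1)).continuousAt.continuousWithinAt)
    refine ⟨max 1 M, fun x hx => ?_⟩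
    by_cases hxd : x < d
    · exact le_max_of_le_left (le_of_lt (hdD ⟨hx.1, hxd⟩))
    · exact le_max_of_le_right (hM x ⟨not_lt.1 hxd, hx.2⟩)
  have key : ∀ n : ℕ, ∀ x ∈ Ioc 0 X, ‖D x‖ ≤ M * ‖q‖ ^ n / n.factorial * x ^ n := by
    intro n
    induction n with
    | zero => simpa using hM
    | succ n ih =>
      set K := M * ‖q‖ ^ n / n.factorial
      have hV' : ∀ x ∈ Ioc 0 X, ‖V x‖ ≤ ‖q‖ * K * x ^ (n + 1) / (n + 1) :=
        norm_le_of_norm_deriv_le_pow hV hV0 fun x hx => by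
          rw [norm_mul, mul_assoc]
          gcongr
          exact ih x hx
      have hD' : ∀ x ∈ Ioc 0 X, ‖V x / x‖ ≤ ‖q‖ * K * x ^ n := fun x hx => by
        rw [norm_div, Complex.norm_real, Real.norm_of_nonneg hx.1.le, div_le_iff₀ hx.1]
        have h0 : 0 ≤ ‖q‖ * K * x ^ (n + 1) := by
          have := (norm_nonneg _).trans (ih x hx)
          calc 0 ≤ ‖q‖ * (K * x ^ n) * x := by have := hx.1.le; positivity
            _ = _ := by ring
        calc ‖V x‖ ≤ ‖q‖ * K * x ^ (n + 1) / (n + 1) := hV' x hx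
          _ ≤ ‖q‖ * K * x ^ (n + 1) := div_le_self h0 (by linarith [n.cast_nonneg (α := ℝ)])
          _ = _ := by ring
      intro x hx
      refine (norm_le_of_norm_deriv_le_pow hD hD0 hD' x hx).trans_eq ?_
      rw [Nat.factorial_succ]
      push_cast
      simp only [K]
      field_simp
      ring
  have hlim : Tendsto (fun n : ℕ => M * ((‖q‖ * X) ^ n / n.factorial)) atTop (𝓝 0) := by
    simpa using (FloorSemiring.tendsto_pow_div_factorial_atTop (‖q‖ * X)).const_mul M
  have h := ge_of_tendsto' hlim fun n => (key n X ⟨hX, le_rfl⟩).trans_eq (by rw [mul_pow]; ring)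
  exact norm_le_zero_iff.1 h

lemma tendsto_macdonaldWeight (a b : ℂ) (t : ℝ) :
    Tendsto (fun r : ℝ => macdonaldWeight a (r * b) t) (𝓝[>] 0) (𝓝 (Complex.exp (-a * t))) := by
  unfold macdonaldWeight
  refine tendsto_nhdsWithin_of_tendsto_nhds (Continuous.tendsto' ?_ 0 _ (by simp))
  simp only [div_eq_mul_inv]
  fun_prop

lemma tendsto_integral_macdonaldWeight {a b : ℂ} (ha : 0 < a.re) (hb : 0 < b.re) :
    Tendsto (fun r : ℝ => ∫ t in Ioi (0 : ℝ), macdonaldWeight a (r * b) t) (𝓝[>] 0)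
      (𝓝 (1 / a)) := by
  rw [← integral_cexp_neg_mul ha]
  refine tendsto_integral_filter_of_dominated_convergence (fun t => Real.exp (-a.re * t))
    (Eventually.of_forall fun r => Measurable.aestronglyMeasurable (by fun_prop)) ?_
    (integrableOn_exp_neg ha) (ae_of_all _ fun t => tendsto_macdonaldWeight a b t)
  filter_upwards [self_mem_nhdsWithin] with r (hr : 0 < r)
  exact (ae_restrict_iff' measurableSet_Ioi).2 (ae_of_all _ fun t (ht : 0 < t) =>
    norm_macdonaldWeight_le a (re_ofReal_mul_pos hr hb).le ht)

lemma tendsto_integral_log_mul_macdonaldWeight {a b : ℂ} (ha : 0 < a.re) (hb : 0 < b.re) :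
    Tendsto (fun r : ℝ => ∫ t in Ioi (0 : ℝ), (Real.log t : ℂ) * macdonaldWeight a (r * b) t)
      (𝓝[>] 0) (𝓝 (∫ t in Ioi (0 : ℝ), (Real.log t : ℂ) * Complex.exp (-a * t))) := by
  refine tendsto_integral_filter_of_dominated_convergence
    (fun t => |Real.log t| * Real.exp (-a.re * t))
    (Eventually.of_forall fun r => Measurable.aestronglyMeasurable (by fun_prop)) ?_
    (integrableOn_abs_log_mul_exp ha)
    (ae_of_all _ fun t => (tendsto_macdonaldWeight a b t).const_mul _)
  filter_upwards [self_mem_nhdsWithin] with r (hr : 0 < r)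
  refine (ae_restrict_iff' measurableSet_Ioi).2 (ae_of_all _ fun t (ht : 0 < t) => ?_)
  rw [norm_mul, Complex.norm_real, Real.norm_eq_abs]
  gcongr
  exact norm_macdonaldWeight_le a (re_ofReal_mul_pos hr hb).le ht

lemma norm_one_sub_cexp_neg_le {z : ℂ} (hz : 0 ≤ z.re) :
    ‖1 - Complex.exp (-z)‖ ≤ 2 * ‖z‖ ^ (1 / 2 : ℝ) := by
  rcases le_total ‖z‖ 1 with h | h
  · rw [norm_sub_rev]
    refine (Complex.norm_exp_sub_one_le (by rwa [norm_neg])).trans ?_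
    rw [norm_neg]
    gcongr
    conv_lhs => rw [← Real.rpow_one ‖z‖]
    exact Real.rpow_le_rpow_of_exponent_ge' (norm_nonneg z) h (by norm_num) (by norm_num)
  · have h1 : ‖Complex.exp (-z)‖ ≤ 1 := by
      rw [Complex.norm_exp]; exact Real.exp_le_one_iff.2 (by simpa using hz)
    have h2 : 1 ≤ ‖z‖ ^ (1 / 2 : ℝ) := Real.one_le_rpow h (by norm_num)
    calc _ ≤ ‖(1 : ℂ)‖ + ‖Complex.exp (-z)‖ := norm_sub_le _ _
      _ ≤ _ := by rw [norm_one]; linarith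

/-- The integral of the weight differs from its limit by `O(√r)`, which beats `log r`. -/
lemma tendsto_log_mul_one_sub {a b : ℂ} (ha : 0 < a.re) (hb : 0 < b.re) :
    Tendsto (fun r : ℝ => (Real.log r : ℂ) *
      (1 - a * ∫ t in Ioi (0 : ℝ), macdonaldWeight a (r * b) t)) (𝓝[>] 0) (𝓝 0) := by
  have ha0 : a ≠ 0 := fun h => by simp [h] at ha
  set K : ℝ := ∫ t in Ioi (0 : ℝ), t ^ (-(1 / 2) : ℝ) * Real.exp (-a.re * t)
  have hI := integrableOn_rpow_mul_exp (s := -(1 / 2)) (by norm_num) ha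
  have hbound : ∀ r : ℝ, 0 < r → ‖1 - a * ∫ t in Ioi (0 : ℝ), macdonaldWeight a (r * b) t‖ ≤
      ‖a‖ * (2 * ‖b‖ ^ (1 / 2 : ℝ) * K) * r ^ (1 / 2 : ℝ) := fun r hr => by
    have h1 : 1 - a * ∫ t in Ioi (0 : ℝ), macdonaldWeight a (r * b) t = a *
        ∫ t in Ioi (0 : ℝ), (Complex.exp (-a * t) - macdonaldWeight a (r * b) t) := by
      rw [integral_sub (integrableOn_cexp ha)
        (integrableOn_macdonaldWeight ha (re_ofReal_mul_pos hr hb)), integral_cexp_neg_mul ha]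
      field_simp
    rw [h1, norm_mul, mul_assoc]
    gcongr
    calc _ ≤ ∫ t in Ioi (0 : ℝ), (2 * ‖b‖ ^ (1 / 2 : ℝ) * r ^ (1 / 2 : ℝ)) *
          (t ^ (-(1 / 2) : ℝ) * Real.exp (-a.re * t)) := by
          refine norm_integral_le_of_norm_le (hI.const_mul _) ?_
          refine (ae_restrict_iff' measurableSet_Ioi).2 (ae_of_all _ fun t (ht : 0 < t) => ?_)
          have h2 : Complex.exp (-a * t) - macdonaldWeight a (r * b) t =
              Complex.exp (-a * t) * (1 - Complex.exp (-(r * b / t))) := by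
            rw [macdonaldWeight, mul_sub, ← Complex.exp_add, mul_one, sub_eq_add_neg (-a * _)]
          rw [h2, norm_mul, norm_cexp_neg_mul]
          have h3 := norm_one_sub_cexp_neg_le (z := r * b / t) (by
            rw [Complex.div_ofReal_re]
            exact div_nonneg (re_ofReal_mul_pos hr hb).le ht.le)
          rw [norm_div, norm_mul, Complex.norm_real, Complex.norm_real, Real.norm_of_nonneg hr.le,
            Real.norm_of_nonneg ht.le, Real.div_rpow (by positivity) ht.le,
            Real.mul_rpow hr.le (norm_nonneg b)] at h3
          refine (mul_le_mul_of_nonneg_left h3 (Real.exp_pos _).le).trans_eq ?_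
          rw [Real.rpow_neg ht.le]; ring
      _ = _ := by rw [integral_const_mul]; ring
  have hlim : Tendsto (fun r : ℝ => |Real.log r * r ^ (1 / 2 : ℝ)| *
      (‖a‖ * (2 * ‖b‖ ^ (1 / 2 : ℝ) * K))) (𝓝[>] 0) (𝓝 0) := by
    have := (tendsto_log_mul_rpow_nhdsGT_zero (r := 1 / 2) (by norm_num)).abs.mul_const
      (‖a‖ * (2 * ‖b‖ ^ (1 / 2 : ℝ) * K))
    simpa only [abs_zero, zero_mul] using this
  refine squeeze_zero_norm' ?_ hlim
  filter_upwards [self_mem_nhdsWithin] with r (hr : 0 < r)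
  rw [norm_mul, Complex.norm_real, Real.norm_eq_abs, abs_mul,
    abs_of_nonneg (Real.rpow_nonneg hr.le _)]
  exact (mul_le_mul_of_nonneg_left (hbound r hr) (abs_nonneg _)).trans_eq (by ring)

lemma tendsto_log_mul_of_hasDerivAt {f : ℂ → ℂ} {f' : ℂ} (hf : HasDerivAt f f' 0) (h0 : f 0 = 0)
    (q : ℂ) : Tendsto (fun r : ℝ => (Real.log r : ℂ) * f (r * q)) (𝓝[>] 0) (𝓝 0) := by
  have h1 : HasDerivAt (fun r : ℝ => f (r * q)) (f' * q) 0 := by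
    have hl : HasDerivAt (fun z : ℂ => z * q) q ((0 : ℝ) : ℂ) := by
      simpa using (hasDerivAt_id ((0 : ℝ) : ℂ)).mul_const q
    have hf0 : HasDerivAt f f' (((0 : ℝ) : ℂ) * q) := by simpa using hf
    exact (HasDerivAt.comp (h := fun z : ℂ => z * q) _ hf0 hl).comp_ofReal
  have h2 := (hasDerivAt_iff_tendsto_slope.1 h1).mono_left
    (nhdsWithin_mono 0 (fun r (hr : 0 < r) => hr.ne'))
  have h3 : Tendsto (fun r : ℝ => ((Real.log r * r ^ (1 : ℝ) : ℝ) : ℂ)) (𝓝[>] 0) (𝓝 0) :=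
    (Complex.continuous_ofReal.tendsto' 0 0 rfl).comp (tendsto_log_mul_rpow_nhdsGT_zero one_pos)
  have h4 := h3.mul h2
  rw [zero_mul] at h4
  refine h4.congr' ?_
  filter_upwards [self_mem_nhdsWithin] with r (hr : 0 < r)
  have hr' : (r : ℂ) ≠ 0 := by exact_mod_cast hr.ne'
  simp only [slope, vsub_eq_sub, sub_zero, Complex.ofReal_zero, zero_mul, h0, Real.rpow_one,
    Complex.real_smul]
  push_cast
  field_simp

/-- The solution `-(l + 2γ) A(w) + 2 B(w)` of the Bessel equation `(w u')' = u`, where `l` is a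
choice of `log w`.  For `w = x² / 4` and `l = 2 log (x / 2)` this is `2 K₀(x)`; for
`w = -x² / 4` and `l = 2 log (x / 2) ± iπ` it is a multiple of a Hankel function. -/
def macdonaldSeries (l w : ℂ) : ℂ :=
  -(l + 2 * Real.eulerMascheroniConstant) * besselSeries w + 2 * harmonicSeries w

theorem macdonaldIntegral_eq_macdonaldSeries {a b : ℂ} (ha : 0 < a.re) (hb : 0 < b.re) :
    macdonaldIntegral a b = macdonaldSeries (Complex.log a + Complex.log b) (a * b) := by
  set q := a * b with hq
  set l := Complex.log a + Complex.log b + 2 * Real.eulerMascheroniConstant with hl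
  -- `C` is the series along the ray `r ↦ r q`, and `W = r C'`.
  let C : ℝ → ℂ := fun r => -(l + Real.log r) * besselSeries (r * q) + 2 * harmonicSeries (r * q)
  let P : ℂ → ℂ := fun w => w * besselSeriesDeriv w
  let Q : ℂ → ℂ := fun w => w * harmonicSeriesDeriv w
  let W : ℝ → ℂ := fun r => -besselSeries (r * q) - (l + Real.log r) * P (r * q) + 2 * Q (r * q)
  let D : ℝ → ℂ := fun r => macdonaldIntegral a (r * b) - C r
  let V : ℝ → ℂ := fun r => -a * (∫ t in Ioi (0 : ℝ), macdonaldWeight a (r * b) t) - W r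
  have hray : ∀ (f : ℂ → ℂ) (f' : ℂ) (r : ℝ), HasDerivAt f f' (r * q) →
      HasDerivAt (fun r : ℝ => f (r * q)) (f' * q) r := fun f f' r hf => by
    have hlin : HasDerivAt (fun z : ℂ => z * q) q (r : ℂ) := by
      simpa using (hasDerivAt_id (r : ℂ)).mul_const q
    exact (HasDerivAt.comp (h := fun z : ℂ => z * q) _ hf hlin).comp_ofReal
  have hlog : ∀ r : ℝ, 0 < r → HasDerivAt (fun r : ℝ => l + (Real.log r : ℂ)) (r : ℂ)⁻¹ r :=
    fun r hr => (hasDerivAt_ofReal_log hr).const_add l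
  have hC : ∀ r : ℝ, 0 < r → HasDerivAt C (W r / r) r := fun r hr => by
    have hr' : (r : ℂ) ≠ 0 := by exact_mod_cast hr.ne'
    have h := ((hlog r hr).neg.mul (hray _ _ r (hasDerivAt_besselSeries _))).add
      ((hray _ _ r (hasDerivAt_harmonicSeries _)).const_mul 2)
    refine h.congr_deriv ?_
    simp only [W, P, Q, Pi.neg_apply]
    field_simp
    ring
  have hW : ∀ r : ℝ, 0 < r → HasDerivAt W (q * C r) r := fun r hr => by
    have hr' : (r : ℂ) ≠ 0 := by exact_mod_cast hr.ne'
    have h := (((hray _ _ r (hasDerivAt_besselSeries _)).neg).sub ((hlog r hr).mul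
      (hray _ _ r (hasDerivAt_mul_besselSeriesDeriv _)))).add
      ((hray _ _ r (hasDerivAt_mul_harmonicSeriesDeriv _)).const_mul 2)
    refine h.congr_deriv ?_
    simp only [C]
    field_simp
    ring
  have hD : ∀ r > 0, HasDerivAt D (V r / r) r := fun r hr => by
    have hr' : (r : ℂ) ≠ 0 := by exact_mod_cast hr.ne'
    have h1 := hasDerivAt_integral_macdonaldWeight ha hb hr 1
    have h2 := integral_macdonaldWeight_parts ha (re_ofReal_mul_pos hr hb)
    simp only [pow_one] at h1
    refine (h1.sub (hC r hr)).congr_deriv ?_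
    simp only [V]
    rw [one_add_one_eq_two]
    generalize ∫ t in Ioi (0 : ℝ), macdonaldWeight a (r * b) t / (t : ℂ) ^ 2 = I₂ at h2 ⊢
    generalize ∫ t in Ioi (0 : ℝ), macdonaldWeight a (r * b) t = I₀ at h2 ⊢
    field_simp
    linear_combination -h2
  have hV : ∀ r > 0, HasDerivAt V (q * D r) r := fun r hr => by
    have h1 := hasDerivAt_integral_macdonaldWeight ha hb hr 0
    simp only [pow_zero, div_one, zero_add, pow_one] at h1
    refine ((h1.const_mul (-a)).sub (hW r hr)).congr_deriv ?_
    simp only [D, macdonaldIntegral]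
    ring
  have hcont : ∀ f : ℂ → ℂ, ContinuousAt f 0 →
      Tendsto (fun r : ℝ => f (r * q)) (𝓝[>] 0) (𝓝 (f 0)) := fun f hf => by
    refine hf.tendsto.comp (tendsto_nhdsWithin_of_tendsto_nhds
      (Continuous.tendsto' ?_ 0 _ (by simp)))
    fun_prop
  have hP := hasDerivAt_mul_besselSeriesDeriv 0
  have hA : Tendsto (fun r : ℝ => besselSeries (r * q)) (𝓝[>] 0) (𝓝 1) := by
    simpa only [besselSeries_zero] using hcont _ continuous_besselSeries.continuousAt
  have hD0 : Tendsto D (𝓝[>] 0) (𝓝 0) := by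
    have t1 := (tendsto_integral_log_mul_macdonaldWeight ha hb).const_mul a
    have t2 := (tendsto_integral_log_mul_macdonaldWeight hb ha).const_mul b
    have t3 := tendsto_log_mul_one_sub hb ha
    have t4 := tendsto_log_mul_of_hasDerivAt ((hasDerivAt_besselSeries 0).sub_const 1)
      (by simp [besselSeries_zero]) q
    have t5 := hcont _ continuous_harmonicSeries.continuousAt
    rw [mul_integral_log_mul_cexp ha] at t1
    rw [mul_integral_log_mul_cexp hb] at t2
    rw [harmonicSeries_zero] at t5
    have h := ((((t1.add t2).add t3).add t4).add (hA.const_mul l)).sub (t5.const_mul 2)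
    have h0 : (-(Real.eulerMascheroniConstant : ℂ) - Complex.log a +
        (-Real.eulerMascheroniConstant - Complex.log b) + 0 + 0 + l * 1 - 2 * 0) = 0 := by
      rw [hl]; ring
    rw [h0] at h
    refine h.congr' ?_
    filter_upwards [self_mem_nhdsWithin] with r (hr : 0 < r)
    simp only [D, C]
    rw [macdonaldIntegral_ofReal_mul ha hb hr]
    ring
  have hV0 : Tendsto V (𝓝[>] 0) (𝓝 0) := by
    have t1 := (tendsto_integral_macdonaldWeight ha hb).const_mul (-a)
    have t2 := hcont P hP.continuousAt
    have t3 := hcont Q (hasDerivAt_mul_harmonicSeriesDeriv 0).continuousAt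
    have t4 := tendsto_log_mul_of_hasDerivAt hP (by simp) q
    have h := (((t1.add hA).add (t2.const_mul l)).add t4).sub (t3.const_mul 2)
    have ha0 : a ≠ 0 := fun h => by simp [h] at ha
    have h0 : -a * (1 / a) + 1 + l * P 0 + 0 - 2 * Q 0 = 0 := by
      simp only [P, Q]; field_simp; ring
    rw [h0] at h
    refine h.congr fun r => ?_
    simp only [V, W, P]
    ring
  have h := eq_zero_of_singular_system hD hV hD0 hV0 one_pos
  simp only [D, C, Complex.ofReal_one, one_mul, Real.log_one, Complex.ofReal_zero, add_zero] at h
  rw [macdonaldSeries]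
  exact sub_eq_zero.1 h

/-! ### A bound for the Macdonald integral up to the imaginary axes -/

lemma norm_macdonaldWeight_le_one {a b : ℂ} (ha : 0 ≤ a.re) (hb : 0 ≤ b.re) {t : ℝ} (ht : 0 < t) :
    ‖macdonaldWeight a b t‖ ≤ 1 :=
  (norm_macdonaldWeight_le a hb ht).trans (Real.exp_le_one_iff.2 (by nlinarith))

lemma le_norm_phase {a b : ℂ} {T t : ℝ} (hT : 0 < T) (hab : ‖b‖ ≤ T ^ 2 * ‖a‖) (ht : 2 * T ≤ t) :
    3 / 4 * ‖a‖ * t ≤ ‖a * t - b / t‖ := by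
  have ht0 : 0 < t := by linarith
  have h1 : ‖b‖ / t ≤ 1 / 4 * ‖a‖ * t := by
    rw [div_le_iff₀ ht0]
    nlinarith [norm_nonneg a, mul_le_mul ht ht (by positivity) ht0.le]
  calc 3 / 4 * ‖a‖ * t ≤ ‖a‖ * t - ‖b‖ / t := by linarith
    _ = ‖a * t‖ - ‖b / t‖ := by
      rw [norm_mul, norm_div, Complex.norm_real, Real.norm_of_nonneg ht0.le]
    _ ≤ _ := norm_sub_norm_le _ _

/-- Beyond `2T` the phase `at + b/t` has no stationary point, and integration by parts against
`1 / (at - b/t)` bounds the tail uniformly as `a` and `b` approach the imaginary axis. -/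
lemma norm_integral_macdonaldWeight_tail_le {a b : ℂ} (ha : 0 < a.re) (hb : 0 < b.re) {T S : ℝ}
    (hT : 0 < T) (hab : ‖b‖ ≤ T ^ 2 * ‖a‖) (hS : 2 * T ≤ S) :
    ‖∫ t in Ioi S, macdonaldWeight a b t / t‖ ≤ 4 / (‖a‖ * S) := by
  have hS0 : 0 < S := by linarith
  have ha0 : 0 < ‖a‖ := norm_pos_iff.2 fun h => by simp [h] at ha
  let v : ℝ → ℂ := fun t => (a * t - b / t)⁻¹
  let v' : ℝ → ℂ := fun t => -(a + b / t ^ 2) / (a * t - b / t) ^ 2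
  have hden : ∀ t ∈ Ici S, 3 / 4 * ‖a‖ * t ≤ ‖a * t - b / t‖ := fun t ht =>
    le_norm_phase hT hab (hS.trans ht)
  have hden0 : ∀ t ∈ Ici S, a * t - b / t ≠ 0 := fun t ht => by
    have ht0 : 0 < t := hS0.trans_le ht
    exact norm_pos_iff.1 (lt_of_lt_of_le (by positivity) (hden t ht))
  have hv : ∀ t ∈ Ici S, ‖v t‖ ≤ 4 / 3 / ‖a‖ * t⁻¹ := fun t ht => by
    have ht0 : 0 < t := hS0.trans_le ht
    rw [norm_inv]
    calc _ ≤ (3 / 4 * ‖a‖ * t)⁻¹ := inv_anti₀ (by positivity) (hden t ht)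
      _ = _ := by field_simp
  have hv' : ∀ t ∈ Ici S, ‖v' t‖ ≤ 20 / 9 / ‖a‖ * t ^ (-2 : ℝ) := fun t ht => by
    have ht0 : 0 < t := hS0.trans_le ht
    have h1 : ‖a + b / t ^ 2‖ ≤ 5 / 4 * ‖a‖ := by
      calc _ ≤ ‖a‖ + ‖b / t ^ 2‖ := norm_add_le _ _
        _ = ‖a‖ + ‖b‖ / t ^ 2 := by
          rw [norm_div, norm_pow, Complex.norm_real, Real.norm_of_nonneg ht0.le]
        _ ≤ ‖a‖ + 1 / 4 * ‖a‖ := by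
          gcongr
          rw [div_le_iff₀ (by positivity)]
          have h2T : 2 * T ≤ t := hS.trans ht
          nlinarith [norm_nonneg a, mul_le_mul h2T h2T (by positivity) ht0.le]
        _ = _ := by ring
    rw [norm_div, norm_neg, norm_pow]
    calc _ ≤ 5 / 4 * ‖a‖ / (3 / 4 * ‖a‖ * t) ^ 2 := by gcongr; exact hden t ht
      _ = _ := by
        rw [Real.rpow_neg ht0.le, Real.rpow_two]
        field_simp
        norm_num
  have hderiv : ∀ t ∈ Ici S, HasDerivAt (fun t => macdonaldWeight a b t * v t)
      (macdonaldWeight a b t * v' t - macdonaldWeight a b t / t) t := fun t ht => by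
    have ht0 : 0 < t := hS0.trans_le ht
    have ht' : (t : ℂ) ≠ 0 := by exact_mod_cast ht0.ne'
    have h0 := hden0 t ht
    have h1 := ((((hasDerivAt_id (t : ℂ)).const_mul a).sub
      ((hasDerivAt_inv ht').const_mul b)).comp_ofReal).inv
      (by simpa [div_eq_mul_inv] using h0)
    have h2 : HasDerivAt v (v' t) t := by
      refine (h1.congr_of_eventuallyEq (Eventually.of_forall fun s => ?_)).congr_deriv ?_
      · simp [v, div_eq_mul_inv]
      · simp [v', div_eq_mul_inv]
    refine ((hasDerivAt_macdonaldWeight a b ht0).mul h2).congr_deriv ?_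
    have h3 : (a - b / t ^ 2) * v t = 1 / t := by
      have h4 : a * t - b / t = t * (a - b / t ^ 2) := by field_simp
      simp only [v]
      rw [h4] at h0 ⊢
      have h5 := right_ne_zero_of_mul h0
      rw [mul_inv, mul_comm (t : ℂ)⁻¹, ← mul_assoc, mul_inv_cancel₀ h5, one_mul, one_div]
    linear_combination -macdonaldWeight a b t * h3
  have hint1 : IntegrableOn (fun t => macdonaldWeight a b t / t) (Ioi S) :=
    (integrableOn_macdonaldWeight_div ha hb).mono_set (Ioi_subset_Ioi hS0.le)
  have hpow : IntegrableOn (fun t : ℝ => 20 / 9 / ‖a‖ * t ^ (-2 : ℝ)) (Ioi S) :=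
    (integrableOn_Ioi_rpow_of_lt (by norm_num) hS0).const_mul _
  have hle : ∀ t ∈ Ioi S, ‖macdonaldWeight a b t * v' t‖ ≤ 20 / 9 / ‖a‖ * t ^ (-2 : ℝ) :=
    fun t ht => by
      have ht0 : 0 < t := hS0.trans ht
      rw [norm_mul]
      calc _ ≤ 1 * ‖v' t‖ := by gcongr; exact norm_macdonaldWeight_le_one ha.le hb.le ht0
        _ ≤ _ := by rw [one_mul]; exact hv' t (Ioi_subset_Ici_self ht)
  have hint2 : IntegrableOn (fun t => macdonaldWeight a b t * v' t) (Ioi S) := by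
    refine hpow.mono' (Measurable.aestronglyMeasurable (by fun_prop)) ?_
    exact (ae_restrict_iff' measurableSet_Ioi).2 (ae_of_all _ hle)
  have hlim : Tendsto (fun t => macdonaldWeight a b t * v t) atTop (𝓝 0) := by
    have h1 : Tendsto (fun t : ℝ => 4 / 3 / ‖a‖ * t⁻¹) atTop (𝓝 0) := by
      simpa using tendsto_inv_atTop_zero.const_mul (4 / 3 / ‖a‖)
    refine squeeze_zero_norm' ?_ h1
    filter_upwards [Ici_mem_atTop S] with t ht
    have ht0 : 0 < t := hS0.trans_le ht
    rw [norm_mul]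
    calc _ ≤ 1 * ‖v t‖ := by gcongr; exact norm_macdonaldWeight_le_one ha.le hb.le ht0
      _ ≤ _ := by rw [one_mul]; exact hv t ht
  have h := integral_Ioi_of_hasDerivAt_of_tendsto' hderiv (hint2.sub hint1) hlim
  rw [integral_sub hint2 hint1] at h
  have h' : ∫ t in Ioi S, macdonaldWeight a b t / t =
      (∫ t in Ioi S, macdonaldWeight a b t * v' t) + macdonaldWeight a b S * v S := by
    linear_combination -h
  rw [h']
  have e1 : ‖∫ t in Ioi S, macdonaldWeight a b t * v' t‖ ≤ 20 / 9 / ‖a‖ * S⁻¹ := by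
    refine (norm_integral_le_of_norm_le hpow
      ((ae_restrict_iff' measurableSet_Ioi).2 (ae_of_all _ hle))).trans_eq ?_
    rw [integral_const_mul, integral_Ioi_rpow_of_lt (by norm_num) hS0]
    congr 1
    norm_num
    rw [Real.rpow_neg_one]
  have e2 : ‖macdonaldWeight a b S * v S‖ ≤ 4 / 3 / ‖a‖ * S⁻¹ := by
    rw [norm_mul]
    calc _ ≤ 1 * ‖v S‖ := by gcongr; exact norm_macdonaldWeight_le_one ha.le hb.le hS0
      _ ≤ _ := by rw [one_mul]; exact hv S self_mem_Ici
  calc _ ≤ 20 / 9 / ‖a‖ * S⁻¹ + 4 / 3 / ‖a‖ * S⁻¹ := norm_add_le_of_le e1 e2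
    _ = 32 / 9 / (‖a‖ * S) := by field_simp; norm_num
    _ ≤ _ := by gcongr; norm_num

/-- The range up to `S = 2T + 1 / |a|` is estimated trivially, which leaves only a logarithm. -/
lemma norm_integral_macdonaldWeight_Ioi_le {a b : ℂ} (ha : 0 < a.re) (hb : 0 < b.re) {T : ℝ}
    (hT : 0 < T) (hab : ‖b‖ ≤ T ^ 2 * ‖a‖) :
    ‖∫ t in Ioi T, macdonaldWeight a b t / t‖ ≤ Real.log (2 + 1 / (‖a‖ * T)) + 4 := by
  have ha0 : 0 < ‖a‖ := norm_pos_iff.2 fun h => by simp [h] at ha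
  set S := 2 * T + 1 / ‖a‖ with hS
  have h1a : 0 < 1 / ‖a‖ := by positivity
  have hTS : T ≤ S := by linarith
  have hint := integrableOn_macdonaldWeight_div ha hb
  rw [← Ioc_union_Ioi_eq_Ioi hTS, setIntegral_union (Ioc_disjoint_Ioi le_rfl) measurableSet_Ioi
    (hint.mono_set fun t ht => hT.trans ht.1)
    (hint.mono_set (Ioi_subset_Ioi (hT.le.trans hTS)))]
  refine norm_add_le_of_le ?_ ?_
  · have hinv : IntegrableOn (fun t : ℝ => t⁻¹) (Ioc T S) := by
      rw [← intervalIntegrable_iff_integrableOn_Ioc_of_le hTS]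
      exact intervalIntegral.intervalIntegrable_inv (fun t ht => by
        rw [uIcc_of_le hTS] at ht; exact (hT.trans_le ht.1).ne') continuousOn_id
    refine (norm_integral_le_of_norm_le hinv ((ae_restrict_iff' measurableSet_Ioc).2
      (ae_of_all _ fun t ht => ?_))).trans_eq ?_
    · have ht0 : 0 < t := hT.trans ht.1
      rw [norm_div, Complex.norm_real, Real.norm_of_nonneg ht0.le, div_eq_mul_inv]
      exact mul_le_of_le_one_left (by positivity) (norm_macdonaldWeight_le_one ha.le hb.le ht0)
    · rw [← intervalIntegral.integral_of_le hTS, integral_inv_of_pos hT (hT.trans_le hTS)]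
      congr 1
      rw [hS]; field_simp
  · refine (norm_integral_macdonaldWeight_tail_le ha hb hT hab (by linarith)).trans ?_
    rw [div_le_iff₀ (by positivity)]
    have : 1 ≤ ‖a‖ * S := by
      rw [hS, mul_add, mul_one_div_cancel ha0.ne']
      nlinarith
    linarith

/-- The substitution `t ↦ 1 / t` interchanges `a` and `b`. -/
lemma integral_macdonaldWeight_Ioo {a b : ℂ} {T : ℝ} (hT : 0 < T) :
    ∫ t in Ioo 0 T, macdonaldWeight a b t / t = ∫ t in Ioi T⁻¹, macdonaldWeight b a t / t := by
  have h1 : ∫ t in Ioo 0 T, macdonaldWeight a b t / t =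
      ∫ t in Ioi (0 : ℝ), (Iio T).indicator (fun t : ℝ => macdonaldWeight a b t / t) t := by
    rw [setIntegral_indicator measurableSet_Iio, Ioi_inter_Iio]
  have h2 : ∫ t in Ioi T⁻¹, macdonaldWeight b a t / t =
      ∫ t in Ioi (0 : ℝ), (Ioi T⁻¹).indicator (fun t : ℝ => macdonaldWeight b a t / t) t := by
    rw [setIntegral_indicator measurableSet_Ioi, Ioi_inter_Ioi, sup_eq_right.2 (by positivity)]
  rw [h1, h2, ← integral_Ioi_comp_div one_pos]
  refine setIntegral_congr_fun measurableSet_Ioi fun t (ht : 0 < t) => ?_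
  have ht' : (t : ℂ) ≠ 0 := by exact_mod_cast ht.ne'
  by_cases h : T⁻¹ < t
  · have h' : 1 / t < T := by rw [one_div]; exact inv_lt_of_inv_lt₀ hT h
    have h3 := macdonaldWeight_comp_div (a := a) (b := b) one_pos ht
    simp only [Complex.ofReal_one, one_mul] at h3
    simp only [indicator_of_mem (mem_Iio.2 h'), indicator_of_mem (mem_Ioi.2 h), h3,
      Complex.real_smul]
    push_cast
    field_simp
  · have h' : ¬ 1 / t < T := fun h' => h (by rw [one_div] at h'; exact inv_lt_of_inv_lt₀ ht h')
    simp only [indicator_of_notMem (s := Iio T) (fun hm => h' (mem_Iio.1 hm)),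
      indicator_of_notMem (s := Ioi T⁻¹) (fun hm => h (mem_Ioi.1 hm)), smul_zero]

/-- The Macdonald integral has only a logarithmic singularity at `ab = 0`, uniformly in the right
half-planes. It is stated as a power bound; the exponent `-1/4` is small enough for
`integrable_abs_N_rpow_mul`. -/
theorem norm_macdonaldIntegral_le {a b : ℂ} (ha : 0 < a.re) (hb : 0 < b.re) :
    ‖macdonaldIntegral a b‖ ≤ 16 * (1 + (‖a‖ * ‖b‖) ^ (-(1 / 4) : ℝ)) := by
  have ha0 : 0 < ‖a‖ := norm_pos_iff.2 fun h => by simp [h] at ha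
  have hb0 : 0 < ‖b‖ := norm_pos_iff.2 fun h => by simp [h] at hb
  -- The stationary scale of `|a| t + |b| / t`.
  set T := √(‖b‖ / ‖a‖) with hTdef
  have hT : 0 < T := Real.sqrt_pos.2 (by positivity)
  have hT2 : T ^ 2 = ‖b‖ / ‖a‖ := Real.sq_sqrt (by positivity)
  set x := 1 / (‖a‖ * T) with hx
  have hx0 : 0 < x := by positivity
  have hbT : 1 / (‖b‖ * T⁻¹) = x := by
    have : ‖b‖ * T⁻¹ = ‖a‖ * T := by
      have : ‖b‖ = T ^ 2 * ‖a‖ := by rw [hT2]; field_simp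
      rw [this]; field_simp
    rw [this]
  have hint := integrableOn_macdonaldWeight_div ha hb
  have h1 := norm_integral_macdonaldWeight_Ioi_le ha hb hT (by rw [hT2]; field_simp; rfl)
  have h2 := norm_integral_macdonaldWeight_Ioi_le hb ha (inv_pos.2 hT) (by
    rw [inv_pow, hT2]; field_simp; rfl)
  rw [hbT] at h2
  have h3 : ‖macdonaldIntegral a b‖ ≤ 2 * (Real.log (2 + x) + 4) := by
    have hdisj : Disjoint (Ioo 0 T) (Ici T) :=
      Set.disjoint_left.2 fun t h h' => not_le.2 h.2 h'
    rw [macdonaldIntegral, ← Ioo_union_Ici_eq_Ioi hT, setIntegral_union hdisj measurableSet_Ici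
      (hint.mono_set fun t ht => ht.1) (hint.mono_set fun t ht => hT.trans_le ht),
      integral_Ici_eq_integral_Ioi, integral_macdonaldWeight_Ioo hT]
    refine (norm_add_le_of_le h2 h1).trans_eq (by ring)
  have hxpow : √x = (‖a‖ * ‖b‖) ^ (-(1 / 4) : ℝ) := by
    have h4 : (‖a‖ * T) ^ 2 = ‖a‖ * ‖b‖ := by rw [mul_pow, hT2]; field_simp
    rw [← h4, ← Real.rpow_natCast, ← Real.rpow_mul (by positivity), hx, Real.sqrt_eq_rpow,
      one_div, Real.inv_rpow (by positivity), ← Real.rpow_neg (by positivity)]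
    norm_num
  have hlog := Real.log_le_rpow_div (x := 2 + x) (by positivity) (ε := 1 / 2) (by norm_num)
  rw [← Real.sqrt_eq_rpow] at hlog
  have hsq : √(2 + x) ≤ 2 + √x := by
    rw [Real.sqrt_le_left (by positivity)]
    nlinarith [Real.sq_sqrt hx0.le, Real.sqrt_nonneg x]
  rw [← hxpow]
  have := Real.sqrt_nonneg x
  linarith

open scoped ENNReal

/-! ### Integrability of negative powers of the quadratic norm -/

lemma lintegral_Ioo_abs_rpow_lt_top :
    ∫⁻ x in Ioo (-1 : ℝ) 1, ENNReal.ofReal |x| ^ (-(1 / 2) : ℝ) < ∞ := by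
  have h0 : IntervalIntegrable (fun x : ℝ => |x| ^ (-(1 / 2) : ℝ)) volume 0 1 := by
    have h := intervalIntegral.intervalIntegrable_rpow' (a := 0) (b := 1) (r := -(1 / 2))
      (by norm_num)
    refine h.congr fun x hx => ?_
    rw [uIoc_of_le zero_le_one] at hx
    simp only [abs_of_pos hx.1]
  have h1 : IntervalIntegrable (fun x : ℝ => |x| ^ (-(1 / 2) : ℝ)) volume 0 (-1) := by
    have h := (IntervalIntegrable.iff_comp_neg (by simp)).1 h0
    simpa using h
  have h2 := (h1.symm.trans h0)
  rw [intervalIntegrable_iff_integrableOn_Ioo_of_le (by norm_num)] at h2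
  refine lt_of_le_of_lt (lintegral_mono_ae ?_) h2.lintegral_lt_top
  refine ae_restrict_of_ae ?_
  have : ∀ᵐ x : ℝ, x ≠ 0 := by simp [ae_iff]
  filter_upwards [this] with x hx
  rw [ENNReal.ofReal_rpow_of_pos (abs_pos.2 hx)]

/-- The total mass of `(1 + x²)⁻¹ dx`. -/
def cauchyMass : ℝ≥0∞ := ∫⁻ x : ℝ, ENNReal.ofReal (1 + x ^ 2)⁻¹

lemma cauchyMass_lt_top : cauchyMass < ∞ := integrable_inv_one_add_sq.lintegral_lt_top

/-- A bound, uniform in the position `y` of the singularity. -/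
lemma lintegral_abs_sub_rpow_le (y : ℝ) :
    ∫⁻ x : ℝ, ENNReal.ofReal |x - y| ^ (-(1 / 2) : ℝ) * ENNReal.ofReal (1 + x ^ 2)⁻¹ ≤
      (∫⁻ x in Ioo (-1 : ℝ) 1, ENNReal.ofReal |x| ^ (-(1 / 2) : ℝ)) + cauchyMass := by
  have htrans : (∫⁻ x in Ioo (-1 : ℝ) 1, ENNReal.ofReal |x| ^ (-(1 / 2) : ℝ)) =
      ∫⁻ x : ℝ, (Ioo (-1 : ℝ) 1).indicator
        (fun x => ENNReal.ofReal |x| ^ (-(1 / 2) : ℝ)) (x - y) := by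
    rw [lintegral_sub_right_eq_self, lintegral_indicator measurableSet_Ioo]
  rw [htrans, cauchyMass, ← lintegral_add_right _ (by fun_prop)]
  refine lintegral_mono fun x => ?_
  have h1 : ENNReal.ofReal (1 + x ^ 2)⁻¹ ≤ 1 := by
    rw [ENNReal.ofReal_le_one]
    exact inv_le_one_of_one_le₀ (by nlinarith)
  by_cases h : x - y ∈ Ioo (-1 : ℝ) 1
  · rw [indicator_of_mem h]
    exact le_add_right (mul_le_of_le_one_right' h1)
  · rw [indicator_of_notMem h, zero_add]
    refine mul_le_of_le_one_left' ?_
    refine ENNReal.rpow_le_one_of_one_le_of_neg ?_ (by norm_num)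
    rw [ENNReal.one_le_ofReal]
    by_contra h'
    exact h (abs_lt.1 (not_le.1 h'))

/-- Here `|x² - q|` is at least the square of the distance from `x` to `{√q, -√q}`; for `q < 0` this
uses the convention `√q = 0`. -/
lemma abs_sq_sub_rpow_le (q x : ℝ) : ENNReal.ofReal |x ^ 2 - q| ^ (-(1 / 4) : ℝ) ≤
    ENNReal.ofReal |x - √q| ^ (-(1 / 2) : ℝ) + ENNReal.ofReal |x + √q| ^ (-(1 / 2) : ℝ) := by
  have key : ∀ y : ℝ, y ^ 2 ≤ |x ^ 2 - q| →
      ENNReal.ofReal |x ^ 2 - q| ^ (-(1 / 4) : ℝ) ≤ ENNReal.ofReal |y| ^ (-(1 / 2) : ℝ) := by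
    intro y hy
    have : ENNReal.ofReal |y| ^ (-(1 / 2) : ℝ) = ENNReal.ofReal (y ^ 2) ^ (-(1 / 4) : ℝ) := by
      rw [← sq_abs, ENNReal.ofReal_pow (abs_nonneg y), ← ENNReal.rpow_natCast, ← ENNReal.rpow_mul]
      norm_num
    rw [this]
    rw [ENNReal.rpow_neg, ENNReal.rpow_neg, ENNReal.inv_le_inv]
    exact ENNReal.rpow_le_rpow (ENNReal.ofReal_le_ofReal hy) (by norm_num)
  have hprod : |x - √q| * |x + √q| ≤ |x ^ 2 - q| := by
    rw [← abs_mul]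
    rcases le_total 0 q with hq | hq
    · refine le_of_eq ?_
      congr 1
      linear_combination -Real.sq_sqrt hq
    · rw [Real.sqrt_eq_zero_of_nonpos hq, sub_zero, add_zero, ← sq, abs_of_nonneg (sq_nonneg x),
        abs_of_nonneg (by nlinarith)]
      linarith
  rcases le_total |x - √q| |x + √q| with h | h
  · refine le_add_right (key _ (le_trans ?_ hprod))
    rw [← sq_abs]
    nlinarith [abs_nonneg (x - √q)]
  · refine le_add_left (key _ (le_trans ?_ hprod))
    rw [← sq_abs]
    nlinarith [abs_nonneg (x + √q)]

lemma exists_lintegral_abs_sq_sub_rpow_le : ∃ C < ∞, ∀ q : ℝ,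
    ∫⁻ x : ℝ, ENNReal.ofReal |x ^ 2 - q| ^ (-(1 / 4) : ℝ) * ENNReal.ofReal (1 + x ^ 2)⁻¹ ≤ C := by
  set K := (∫⁻ x in Ioo (-1 : ℝ) 1, ENNReal.ofReal |x| ^ (-(1 / 2) : ℝ)) + cauchyMass
  have hK : K < ∞ := ENNReal.add_lt_top.2 ⟨lintegral_Ioo_abs_rpow_lt_top, cauchyMass_lt_top⟩
  refine ⟨K + K, ENNReal.add_lt_top.2 ⟨hK, hK⟩, fun q => ?_⟩
  have h2 := lintegral_abs_sub_rpow_le (-√q)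
  simp only [sub_neg_eq_add] at h2
  refine le_trans ?_ (add_le_add (lintegral_abs_sub_rpow_le (√q)) h2)
  rw [← lintegral_add_right _ (by fun_prop)]
  refine lintegral_mono fun x => ?_
  rw [← add_mul]
  gcongr
  exact abs_sq_sub_rpow_le q x

/-- The product `∏ (1 + xᵢ²)⁻¹` of Cauchy densities. -/
def cauchyWeight (x : HR) : ℝ := ∏ i, (1 + x i ^ 2)⁻¹

/-- The integral over the first coordinate is bounded uniformly in the other three. In `[0, ∞]` the
integrand is infinite on the null cone, so that the finiteness also shows the cone to be null. -/
lemma lintegral_abs_N_rpow_lt_top :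
    ∫⁻ x : HR, ENNReal.ofReal |N x| ^ (-(1 / 4) : ℝ) * ENNReal.ofReal (cauchyWeight x) < ∞ := by
  obtain ⟨C, hC, hCq⟩ := exists_lintegral_abs_sq_sub_rpow_le
  let q : (Fin 3 → ℝ) → ℝ := fun y => -(y 0 ^ 2 - y 1 ^ 2 - y 2 ^ 2)
  let F : ℝ × (Fin 3 → ℝ) → ℝ≥0∞ := fun p =>
    ENNReal.ofReal |p.1 ^ 2 - q p.2| ^ (-(1 / 4) : ℝ) * ENNReal.ofReal (1 + p.1 ^ 2)⁻¹ *
      ENNReal.ofReal (∏ i, (1 + p.2 i ^ 2)⁻¹)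
  have hF : Measurable F := by fun_prop
  have hmp := (volume_preserving_piFinSuccAbove (fun _ : Fin 4 => ℝ) 0).comp
    (PiLp.volume_preserving_ofLp (Fin 4))
  have heq : (∫⁻ x : HR, ENNReal.ofReal |N x| ^ (-(1 / 4) : ℝ) * ENNReal.ofReal (cauchyWeight x)) =
      ∫⁻ p : ℝ × (Fin 3 → ℝ), F p := by
    rw [← hmp.lintegral_comp hF]
    refine lintegral_congr fun x => ?_
    have h1 : N x = x 0 ^ 2 - q (fun i => x i.succ) := by
      simp [N, q]; ring
    have h2 : cauchyWeight x = (1 + x 0 ^ 2)⁻¹ * ∏ i : Fin 3, (1 + x i.succ ^ 2)⁻¹ := by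
      rw [cauchyWeight, Fin.prod_univ_succ]
    rw [h1, h2, ENNReal.ofReal_mul (by positivity), ← mul_assoc]
    rfl
  rw [heq, Measure.volume_eq_prod, lintegral_prod_symm' _ hF]
  have hprod : Integrable (fun y : Fin 3 → ℝ => ∏ i, (1 + y i ^ 2)⁻¹) :=
    Integrable.fintype_prod (f := fun (_ : Fin 3) (x : ℝ) => (1 + x ^ 2)⁻¹)
      fun _ => integrable_inv_one_add_sq
  calc _ ≤ ∫⁻ y : Fin 3 → ℝ, C * ENNReal.ofReal (∏ i, (1 + y i ^ 2)⁻¹) := by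
        refine lintegral_mono fun y => ?_
        simp only [F]
        rw [lintegral_mul_const _ (by fun_prop)]
        gcongr
        exact hCq (q y)
    _ = C * ∫⁻ y : Fin 3 → ℝ, ENNReal.ofReal (∏ i, (1 + y i ^ 2)⁻¹) :=
        lintegral_const_mul _ (by fun_prop)
    _ < ∞ := ENNReal.mul_lt_top hC hprod.lintegral_lt_top

@[fun_prop]
lemma continuous_N : Continuous N := by unfold N; fun_prop

lemma cauchyWeight_pos (x : HR) : 0 < cauchyWeight x :=
  Finset.prod_pos fun i _ => by positivity

lemma continuous_cauchyWeight : Continuous cauchyWeight := by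
  unfold cauchyWeight
  exact continuous_finsetProd _ fun i _ => Continuous.inv₀ (by fun_prop) fun x => by positivity

/-- The null cone has measure zero. -/
lemma ae_N_ne_zero : ∀ᵐ x : HR, N x ≠ 0 := by
  have hm : Measurable fun x : HR =>
      ENNReal.ofReal |N x| ^ (-(1 / 4) : ℝ) * ENNReal.ofReal (cauchyWeight x) := by
    have := continuous_cauchyWeight.measurable
    have := continuous_N.measurable
    fun_prop
  filter_upwards [ae_lt_top hm lintegral_abs_N_rpow_lt_top.ne] with x hx h0
  rw [h0, abs_zero, ENNReal.ofReal_zero, ENNReal.zero_rpow_of_neg (by norm_num),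
    ENNReal.top_mul (by simpa using cauchyWeight_pos x)] at hx
  exact lt_irrefl _ hx

lemma integrable_abs_N_rpow_mul_cauchyWeight :
    Integrable fun x : HR => |N x| ^ (-(1 / 4) : ℝ) * cauchyWeight x := by
  have hm := continuous_cauchyWeight.measurable
  have hm' := continuous_N.measurable
  refine ⟨Measurable.aestronglyMeasurable (by fun_prop), ?_⟩
  rw [hasFiniteIntegral_iff_ofReal (ae_of_all _ fun x =>
    mul_nonneg (by positivity) (cauchyWeight_pos x).le)]
  refine lt_of_le_of_lt (lintegral_mono_ae ?_) lintegral_abs_N_rpow_lt_top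
  filter_upwards [ae_N_ne_zero] with x hx
  rw [ENNReal.ofReal_mul (by positivity), ENNReal.ofReal_rpow_of_pos (abs_pos.2 hx)]

lemma exists_norm_le_cauchyWeight (φ : 𝓢(HR, ℂ)) :
    ∃ K, 0 ≤ K ∧ ∀ x, ‖φ x‖ ≤ K * cauchyWeight x := by
  have h := SchwartzMap.one_add_le_sup_seminorm_apply (𝕜 := ℝ) (m := (8, 0)) (k := 8) (n := 0)
    le_rfl le_rfl φ
  set K := 2 ^ 8 * ((Finset.Iic (8, 0)).sup fun m => SchwartzMap.seminorm ℝ m.1 m.2) φ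
  have hK : 0 ≤ K := by positivity
  refine ⟨K, hK, fun x => ?_⟩
  have hx : (1 + ‖x‖) ^ 8 * ‖φ x‖ ≤ K := by simpa using h x
  have hprod : ∏ i, (1 + x i ^ 2) ≤ (1 + ‖x‖) ^ 8 := by
    calc ∏ i, (1 + x i ^ 2) ≤ ∏ _i : Fin 4, (1 + ‖x‖) ^ 2 := by
          refine Finset.prod_le_prod (fun i _ => by positivity) fun i _ => ?_
          have h1 : |x i| ≤ ‖x‖ := PiLp.norm_apply_le x i
          nlinarith [sq_abs (x i), abs_nonneg (x i)]
      _ = (1 + ‖x‖) ^ 8 := by rw [Finset.prod_const, ← pow_mul]; rfl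
  have hpos : 0 < ∏ i, (1 + x i ^ 2) := Finset.prod_pos fun i _ => by positivity
  rw [cauchyWeight, Finset.prod_inv_distrib, ← div_eq_mul_inv, le_div_iff₀ hpos]
  nlinarith [norm_nonneg (φ x)]

lemma integrable_abs_N_rpow_mul (φ : 𝓢(HR, ℂ)) :
    Integrable fun x : HR => |N x| ^ (-(1 / 4) : ℝ) * ‖φ x‖ := by
  obtain ⟨K, hK, hφ⟩ := exists_norm_le_cauchyWeight φ
  have hm := φ.continuous.measurable
  have hm' := continuous_N.measurable
  refine (integrable_abs_N_rpow_mul_cauchyWeight.const_mul K).mono'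
    (Measurable.aestronglyMeasurable (by fun_prop)) (ae_of_all _ fun x => ?_)
  rw [Real.norm_of_nonneg (by positivity)]
  calc _ ≤ |N x| ^ (-(1 / 4) : ℝ) * (K * cauchyWeight x) := by gcongr; exact hφ x
    _ = _ := by ring

/-! ### The Fourier transform of the oscillating Gaussian `e^{itN}` -/

open scoped FourierTransform in
lemma fourier_eq_comp_smul (φ : 𝓢(HR, ℂ)) (X : HR) :
    fourier φ X = 1 / (2 * Real.pi) ^ 2 * (𝓕 φ : 𝓢(HR, ℂ)) (-(2 * Real.pi)⁻¹ • X) := by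
  rw [fourier, SchwartzMap.fourier_coe, Real.fourier_eq']
  congr 1
  refine integral_congr_ae (ae_of_all _ fun ξ => ?_)
  have h : -2 * Real.pi * inner ℝ ξ (-(2 * Real.pi)⁻¹ • X) = inner ℝ X ξ := by
    rw [inner_smul_right, real_inner_comm]
    have := Real.pi_ne_zero
    field_simp
  simp only [h, smul_eq_mul]
  rw [mul_comm Complex.I, mul_comm]

lemma continuous_fourier (φ : 𝓢(HR, ℂ)) : Continuous (fourier φ) := by
  rw [funext (fourier_eq_comp_smul φ)]
  exact continuous_const.mul ((SchwartzMap.continuous _).comp (continuous_const_smul _))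

lemma integrable_fourier (φ : 𝓢(HR, ℂ)) : Integrable (fourier φ) := by
  rw [funext (fourier_eq_comp_smul φ)]
  exact ((SchwartzMap.integrable _).comp_smul
    (neg_ne_zero.2 (inv_ne_zero (by positivity)))).const_mul _

/-- The coefficients of the quadratic form `ρ |X|² - i t N(X)`. -/
def gaussCoeff (ρ t : ℝ) : Fin 4 → ℂ :=
  ![ρ - Complex.I * t, ρ - Complex.I * t, ρ + Complex.I * t, ρ + Complex.I * t]

/-- The Gaussian `e^{-ρ |X|² + i t N(X)}`. -/
def gaussKernel (ρ t : ℝ) (X : HR) : ℂ := Complex.exp (-∑ i, gaussCoeff ρ t i * (X i : ℂ) ^ 2)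

/-- The Gaussian `e^{-∑ ηᵢ² / (4 bᵢ)}` dual to `gaussKernel`, where `b = gaussCoeff ρ t`. -/
def dualGaussKernel (ρ t : ℝ) (η : HR) : ℂ :=
  Complex.exp (-∑ i, (η i : ℂ) ^ 2 / (4 * gaussCoeff ρ t i))

lemma re_gaussCoeff (ρ t : ℝ) (i : Fin 4) : (gaussCoeff ρ t i).re = ρ := by
  fin_cases i <;> simp [gaussCoeff]

lemma norm_gaussKernel_le_one {ρ : ℝ} (hρ : 0 ≤ ρ) (t : ℝ) (X : HR) : ‖gaussKernel ρ t X‖ ≤ 1 := by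
  rw [gaussKernel, Complex.norm_exp, Real.exp_le_one_iff, Complex.neg_re, Complex.re_sum]
  refine neg_nonpos.2 (Finset.sum_nonneg fun i _ => ?_)
  rw [← Complex.ofReal_pow, Complex.re_mul_ofReal, re_gaussCoeff]
  positivity

lemma norm_dualGaussKernel_le_one {ρ : ℝ} (hρ : 0 ≤ ρ) (t : ℝ) (η : HR) :
    ‖dualGaussKernel ρ t η‖ ≤ 1 := by
  rw [dualGaussKernel, Complex.norm_exp, Real.exp_le_one_iff, Complex.neg_re, Complex.re_sum]
  refine neg_nonpos.2 (Finset.sum_nonneg fun i _ => ?_)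
  have : (η i : ℂ) ^ 2 / (4 * gaussCoeff ρ t i) =
      ((η i ^ 2 / 4 : ℝ) : ℂ) * (gaussCoeff ρ t i)⁻¹ := by
    push_cast; rw [div_mul_eq_div_div, div_eq_mul_inv]
  rw [this, Complex.re_ofReal_mul, Complex.inv_re, re_gaussCoeff]
  have := Complex.normSq_nonneg (gaussCoeff ρ t i)
  positivity

lemma measurableEmbedding_ofLp : MeasurableEmbedding (@WithLp.ofLp 2 (Fin 4 → ℝ)) :=
  (MeasurableEquiv.toLp 2 (Fin 4 → ℝ)).symm.measurableEmbedding

@[fun_prop]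
lemma continuous_gaussKernel (ρ t : ℝ) : Continuous (gaussKernel ρ t) := by
  unfold gaussKernel; fun_prop

@[fun_prop]
lemma continuous_dualGaussKernel (ρ t : ℝ) : Continuous (dualGaussKernel ρ t) := by
  unfold dualGaussKernel; simp only [div_eq_mul_inv]; fun_prop

lemma integrable_gaussKernel {ρ : ℝ} (hρ : 0 < ρ) (t : ℝ) : Integrable (gaussKernel ρ t) := by
  have h := GaussianFourier.integrable_cexp_neg_sum_mul_add (b := gaussCoeff ρ t)
    (fun i => by rwa [re_gaussCoeff]) 0
  have h' := ((PiLp.volume_preserving_ofLp (Fin 4)).integrable_comp_emb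
    measurableEmbedding_ofLp).2 h
  refine h'.congr (ae_of_all _ fun X => ?_)
  simp [gaussKernel]

lemma cpow_half_mul_self {z : ℂ} (hz : z ≠ 0) : z ^ (1 / 2 : ℂ) * z ^ (1 / 2 : ℂ) = z := by
  rw [← Complex.cpow_add _ _ hz]; norm_num

lemma integral_gaussKernel_mul_cexp {ρ : ℝ} (hρ : 0 < ρ) (t : ℝ) (ξ : HR) :
    ∫ X, gaussKernel ρ t X * Complex.exp (Complex.I * (inner ℝ X ξ : ℝ)) =
      Real.pi ^ 2 / (ρ ^ 2 + t ^ 2) * dualGaussKernel ρ t ξ := by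
  have h := GaussianFourier.integral_cexp_neg_sum_mul_add (b := gaussCoeff ρ t)
    (fun i => by rwa [re_gaussCoeff]) (fun i => Complex.I * ξ i)
  rw [← (PiLp.volume_preserving_ofLp (Fin 4)).integral_comp measurableEmbedding_ofLp] at h
  have hne : ∀ i, gaussCoeff ρ t i ≠ 0 := fun i h0 => by
    have := re_gaussCoeff ρ t i
    rw [h0, Complex.zero_re] at this
    exact hρ.ne this
  have hpi : (Real.pi : ℂ) ≠ 0 := by exact_mod_cast Real.pi_ne_zero
  have h0 := hne 0
  have h2 := hne 2
  simp only [gaussCoeff, Matrix.cons_val] at h0 h2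
  calc _ = ∫ X : HR, Complex.exp (-∑ i, gaussCoeff ρ t i * (X i : ℂ) ^ 2 +
        ∑ i, Complex.I * ξ i * (X i : ℂ)) := by
        refine integral_congr_ae (ae_of_all _ fun X => ?_)
        simp only [gaussKernel, ← Complex.exp_add]
        congr 2
        rw [EuclideanSpace.inner_eq_star_dotProduct, dotProduct]
        push_cast
        rw [Finset.mul_sum]
        refine Finset.sum_congr rfl fun i _ => ?_
        simp; ring
    _ = _ := h
    _ = (∏ i, (Real.pi / gaussCoeff ρ t i) ^ (1 / 2 : ℂ)) * dualGaussKernel ρ t ξ := by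
        rw [Finset.prod_mul_distrib, ← Complex.exp_sum, dualGaussKernel,
          ← Finset.sum_neg_distrib]
        congr 2
        refine Finset.sum_congr rfl fun i _ => ?_
        rw [mul_pow, Complex.I_sq]; ring
    _ = _ := by
        congr 1
        simp only [Fin.prod_univ_four, gaussCoeff, Matrix.cons_val]
        rw [mul_assoc, cpow_half_mul_self (div_ne_zero hpi h0),
          cpow_half_mul_self (div_ne_zero hpi h2), div_mul_div_comm]
        congr 1
        · ring
        · linear_combination -(t : ℂ) ^ 2 * Complex.I_sq

/-- Parseval's formula for the Gaussian `e^{-ρ |X|² + i t N(X)}`. -/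
lemma integral_gaussKernel_mul_fourier {ρ : ℝ} (hρ : 0 < ρ) (t : ℝ) (φ : 𝓢(HR, ℂ)) :
    ∫ X, gaussKernel ρ t X * fourier φ X =
      1 / (4 * (ρ ^ 2 + t ^ 2)) * ∫ ξ, φ ξ * dualGaussKernel ρ t ξ := by
  have hint : Integrable (Function.uncurry fun (X ξ : HR) =>
      gaussKernel ρ t X * φ ξ * Complex.exp (Complex.I * (inner ℝ X ξ : ℝ))) := by
    refine ((integrable_gaussKernel hρ t).mul_prod φ.integrable).mono
      (Continuous.aestronglyMeasurable ?_) (ae_of_all _ fun p => ?_)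
    · have := φ.continuous
      simp only [Function.uncurry_def]
      fun_prop
    · simp only [Function.uncurry_def, norm_mul]
      rw [mul_comm Complex.I, Complex.norm_exp_ofReal_mul_I, mul_one]
  have hpi : (Real.pi : ℂ) ≠ 0 := by exact_mod_cast Real.pi_ne_zero
  calc _ = 1 / (2 * Real.pi) ^ 2 * ∫ X, ∫ ξ, gaussKernel ρ t X * φ ξ *
        Complex.exp (Complex.I * (inner ℝ X ξ : ℝ)) := by
        rw [← integral_const_mul]
        refine integral_congr_ae (ae_of_all _ fun X => ?_)
        simp only [fourier, mul_assoc]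
        rw [integral_const_mul]
        ring
    _ = 1 / (2 * Real.pi) ^ 2 * ∫ ξ, ∫ X, gaussKernel ρ t X * φ ξ *
        Complex.exp (Complex.I * (inner ℝ X ξ : ℝ)) := by rw [integral_integral_swap hint]
    _ = 1 / (2 * Real.pi) ^ 2 * ∫ ξ, Real.pi ^ 2 / (ρ ^ 2 + t ^ 2) *
        (φ ξ * dualGaussKernel ρ t ξ) := by
        congr 1
        refine integral_congr_ae (ae_of_all _ fun ξ => ?_)
        simp only
        rw [mul_left_comm, ← integral_gaussKernel_mul_cexp hρ, ← integral_const_mul]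
        refine integral_congr_ae (ae_of_all _ fun X => ?_)
        simp only
        ring
    _ = _ := by
        rw [integral_const_mul, ← mul_assoc]
        congr 1
        have hnz : (ρ : ℂ) ^ 2 + (t : ℂ) ^ 2 ≠ 0 := by
          have : (0 : ℝ) < ρ ^ 2 + t ^ 2 := by positivity
          exact_mod_cast this.ne'
        field_simp
        norm_num

lemma gaussKernel_zero (t : ℝ) (X : HR) :
    gaussKernel 0 t X = Complex.exp (Complex.I * t * N X) := by
  rw [gaussKernel]
  congr 1
  simp [Fin.sum_univ_four, gaussCoeff, N]
  ring

lemma dualGaussKernel_zero {t : ℝ} (ht : t ≠ 0) (η : HR) :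
    dualGaussKernel 0 t η = Complex.exp (-(Complex.I * N η / (4 * t))) := by
  have ht' : (t : ℂ) ≠ 0 := by exact_mod_cast ht
  rw [dualGaussKernel]
  congr 2
  simp only [Fin.sum_univ_four, gaussCoeff, N, Matrix.cons_val, Complex.ofReal_zero, zero_sub,
    zero_add]
  have hI := Complex.I_ne_zero
  push_cast
  field_simp
  linear_combination ((η 0 : ℂ) ^ 2 + (η 1 : ℂ) ^ 2 - (η 2 : ℂ) ^ 2 - (η 3 : ℂ) ^ 2) *
    (-Complex.I_sq)

/-- The Fourier transform of `e^{itN}` is `(4t²)⁻¹ e^{-iN/(4t)}`: the signature is zero, so there is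
no phase factor. -/
theorem integral_cexp_N_mul_fourier {t : ℝ} (ht : t ≠ 0) (φ : 𝓢(HR, ℂ)) :
    ∫ X, Complex.exp (Complex.I * t * N X) * fourier φ X =
      1 / (4 * t ^ 2) * ∫ ξ, φ ξ * Complex.exp (-(Complex.I * N ξ / (4 * t))) := by
  have hcoeff : ∀ i, Continuous fun ρ : ℝ => gaussCoeff ρ t i := fun i => by
    fin_cases i <;> simp only [gaussCoeff] <;> simp <;> fun_prop
  have hcoeff0 : ∀ i, gaussCoeff 0 t i ≠ 0 := fun i => by
    fin_cases i <;> simp [gaussCoeff, ht]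
  have hL : Tendsto (fun ρ : ℝ => ∫ X, gaussKernel ρ t X * fourier φ X) (𝓝[>] 0)
      (𝓝 (∫ X, gaussKernel 0 t X * fourier φ X)) := by
    refine tendsto_integral_filter_of_dominated_convergence (fun X => ‖fourier φ X‖)
      (Eventually.of_forall fun ρ => Continuous.aestronglyMeasurable ?_) ?_
      (integrable_fourier φ).norm (ae_of_all _ fun X => ?_)
    · exact (continuous_gaussKernel ρ t).mul (continuous_fourier φ)
    · filter_upwards [self_mem_nhdsWithin] with ρ (hρ : 0 < ρ)
      refine ae_of_all _ fun X => ?_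
      rw [norm_mul]
      exact mul_le_of_le_one_left (norm_nonneg _) (norm_gaussKernel_le_one hρ.le t X)
    · refine (tendsto_nhdsWithin_of_tendsto_nhds (Continuous.tendsto ?_ 0)).mul_const _
      unfold gaussKernel
      fun_prop
  have hR : Tendsto (fun ρ : ℝ => ∫ ξ, φ ξ * dualGaussKernel ρ t ξ) (𝓝[>] 0)
      (𝓝 (∫ ξ, φ ξ * dualGaussKernel 0 t ξ)) := by
    refine tendsto_integral_filter_of_dominated_convergence (fun X => ‖φ X‖)
      (Eventually.of_forall fun ρ => Continuous.aestronglyMeasurable ?_) ?_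
      φ.integrable.norm (ae_of_all _ fun X => ?_)
    · exact φ.continuous.mul (continuous_dualGaussKernel ρ t)
    · filter_upwards [self_mem_nhdsWithin] with ρ (hρ : 0 < ρ)
      refine ae_of_all _ fun X => ?_
      rw [norm_mul]
      exact mul_le_of_le_one_right (norm_nonneg _) (norm_dualGaussKernel_le_one hρ.le t X)
    · refine (tendsto_nhdsWithin_of_tendsto_nhds ?_).const_mul _
      unfold dualGaussKernel
      refine (Complex.continuous_exp.tendsto _).comp (Tendsto.neg (tendsto_finsetSum _ fun i _ =>
        tendsto_const_nhds.div (((hcoeff i).tendsto 0).const_mul 4)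
          (mul_ne_zero (by norm_num) (hcoeff0 i))))
  have ht' : (t : ℂ) ≠ 0 := by exact_mod_cast ht
  have hc : Tendsto (fun ρ : ℝ => 1 / (4 * ((ρ : ℂ) ^ 2 + (t : ℂ) ^ 2))) (𝓝[>] 0)
      (𝓝 (1 / (4 * (t : ℂ) ^ 2))) := by
    refine tendsto_nhdsWithin_of_tendsto_nhds (tendsto_const_nhds.div ?_ (by simpa using ht))
    exact Continuous.tendsto' (by fun_prop) 0 _ (by simp)
  have h := tendsto_nhds_unique (hL.congr' ?_) (hc.mul hR)
  · simpa only [gaussKernel_zero, dualGaussKernel_zero ht] using h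
  · filter_upwards [self_mem_nhdsWithin] with ρ (hρ : 0 < ρ)
    exact integral_gaussKernel_mul_fourier hρ t φ

/-! ### Boundary values of the Macdonald integral -/

lemma tendsto_macdonaldSeries {ι : Type*} {l : Filter ι} {u v : ι → ℂ} {a b : ℂ}
    (hu : Tendsto u l (𝓝 a)) (hv : Tendsto v l (𝓝 b)) :
    Tendsto (fun i => macdonaldSeries (u i) (v i)) l (𝓝 (macdonaldSeries a b)) := by
  unfold macdonaldSeries
  exact ((hu.add_const _).neg.mul ((continuous_besselSeries.tendsto b).comp hv)).add
    (((continuous_harmonicSeries.tendsto b).comp hv).const_mul 2)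

lemma measurable_macdonaldSeries {α : Type*} [MeasurableSpace α] {u v : α → ℂ}
    (hu : Measurable u) (hv : Measurable v) : Measurable fun x => macdonaldSeries (u x) (v x) := by
  unfold macdonaldSeries
  exact ((hu.add_const _).neg.mul (continuous_besselSeries.measurable.comp hv)).add
    ((continuous_harmonicSeries.measurable.comp hv).const_mul 2)

/-- The value at `(a, iy)` of the continuous extension of the Macdonald integral. -/
def macdonaldBoundary (a : ℂ) (y : ℝ) : ℂ :=
  macdonaldSeries (Complex.log a + Complex.log (Complex.I * y)) (a * (Complex.I * y))

lemma tendsto_macdonaldSeries_log {ι : Type*} {l : Filter ι} {u v : ι → ℂ} {a b : ℂ}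
    (ha : a ∈ Complex.slitPlane) (hb : b ∈ Complex.slitPlane) (hu : Tendsto u l (𝓝 a))
    (hv : Tendsto v l (𝓝 b)) :
    Tendsto (fun i => macdonaldSeries (Complex.log (u i) + Complex.log (v i)) (u i * v i)) l
      (𝓝 (macdonaldSeries (Complex.log a + Complex.log b) (a * b))) :=
  tendsto_macdonaldSeries ((hu.clog ha).add (hv.clog hb)) (hu.mul hv)

lemma I_mul_mem_slitPlane {y : ℝ} (hy : y ≠ 0) : Complex.I * y ∈ Complex.slitPlane :=
  Or.inr (by simpa using hy)

lemma mem_slitPlane_of_re_nonneg {a : ℂ} (ha : 0 ≤ a.re) (ha0 : a ≠ 0) : a ∈ Complex.slitPlane := by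
  rcases ha.lt_or_eq with h | h
  · exact Or.inl h
  · exact Or.inr fun him => ha0 (Complex.ext h.symm him)

lemma tendsto_ofReal_add (b : ℂ) : Tendsto (fun d : ℝ => (d : ℂ) + b) (𝓝[>] 0) (𝓝 b) :=
  tendsto_nhdsWithin_of_tendsto_nhds (Continuous.tendsto' (by fun_prop) 0 _ (by simp))

lemma tendsto_macdonaldIntegral_ofReal_add {a : ℂ} (ha : 0 < a.re) {y : ℝ} (hy : y ≠ 0) :
    Tendsto (fun d : ℝ => macdonaldIntegral a (d + Complex.I * y)) (𝓝[>] 0)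
      (𝓝 (macdonaldBoundary a y)) := by
  refine (tendsto_macdonaldSeries_log (Or.inl ha) (I_mul_mem_slitPlane hy) tendsto_const_nhds
    (tendsto_ofReal_add _)).congr' ?_
  filter_upwards [self_mem_nhdsWithin] with d (hd : 0 < d)
  rw [macdonaldIntegral_eq_macdonaldSeries ha (by simpa using hd)]

lemma norm_macdonaldBoundary_le {a : ℂ} (ha : 0 ≤ a.re) (ha0 : a ≠ 0) {y : ℝ} (hy : y ≠ 0) :
    ‖macdonaldBoundary a y‖ ≤ 16 * (1 + (‖a‖ * |y|) ^ (-(1 / 4) : ℝ)) := by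
  have h1 : Tendsto (fun d : ℝ => macdonaldIntegral (d + a) (d + Complex.I * y)) (𝓝[>] 0)
      (𝓝 (macdonaldBoundary a y)) := by
    refine (tendsto_macdonaldSeries_log (mem_slitPlane_of_re_nonneg ha ha0)
      (I_mul_mem_slitPlane hy) (tendsto_ofReal_add _) (tendsto_ofReal_add _)).congr' ?_
    filter_upwards [self_mem_nhdsWithin] with d (hd : 0 < d)
    rw [macdonaldIntegral_eq_macdonaldSeries (by simpa using by linarith) (by simpa using hd)]
  have hpos : 0 < ‖a‖ * |y| := mul_pos (norm_pos_iff.2 ha0) (abs_pos.2 hy)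
  have hyn : ‖Complex.I * (y : ℂ)‖ = |y| := by simp
  have h2 : Tendsto (fun d : ℝ => 16 * (1 + (‖(d : ℂ) + a‖ * ‖(d : ℂ) + Complex.I * y‖) ^
      (-(1 / 4) : ℝ))) (𝓝[>] 0) (𝓝 (16 * (1 + (‖a‖ * |y|) ^ (-(1 / 4) : ℝ)))) := by
    have h3 := (tendsto_ofReal_add a).norm.mul (tendsto_ofReal_add (Complex.I * y)).norm
    rw [hyn] at h3
    exact ((h3.rpow_const (Or.inl hpos.ne')).const_add 1).const_mul 16
  refine le_of_tendsto_of_tendsto h1.norm h2 ?_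
  filter_upwards [self_mem_nhdsWithin] with d (hd : 0 < d)
  exact norm_macdonaldIntegral_le (by simpa using by linarith) (by simpa using hd)

lemma measurable_macdonaldBoundary (a : ℂ) : Measurable (macdonaldBoundary a) := by
  unfold macdonaldBoundary
  exact measurable_macdonaldSeries (by fun_prop) (by fun_prop)

lemma continuousOn_macdonaldBoundary {a : ℂ} (ha : a ∈ Complex.slitPlane) :
    ContinuousOn (macdonaldBoundary a) {0}ᶜ := fun y hy => by
  refine ContinuousAt.continuousWithinAt ?_
  refine tendsto_macdonaldSeries_log ha (I_mul_mem_slitPlane hy) tendsto_const_nhds ?_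
  exact Continuous.tendsto (by fun_prop) y

/-! ### Parseval's formula for the negative second power of `a - iσN` -/

/-- The dominating function for all pairings of boundary values with `φ`. -/
def boundaryBound (r : ℝ) (φ : HR → ℂ) (ξ : HR) : ℝ :=
  16 * (‖φ ξ‖ + (r / 4) ^ (-(1 / 4) : ℝ) * (|N ξ| ^ (-(1 / 4) : ℝ) * ‖φ ξ‖))

lemma integrable_boundaryBound (r : ℝ) (φ : 𝓢(HR, ℂ)) : Integrable (boundaryBound r φ) :=
  (φ.integrable.norm.add ((integrable_abs_N_rpow_mul φ).const_mul _)).const_mul _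

lemma mul_norm_le_boundaryBound {r s n C : ℝ} (hr : 0 < r) {φ : HR → ℂ} {ξ : HR} (hN : N ξ ≠ 0)
    (hrs : r ≤ s) (hn : |N ξ| / 4 ≤ n) (hC : C ≤ 16 * (1 + (s * n) ^ (-(1 / 4) : ℝ))) :
    C * ‖φ ξ‖ ≤ boundaryBound r φ ξ := by
  have hN' := abs_pos.2 hN
  have hs : 0 ≤ s := hr.le.trans hrs
  have h1 : (s * n) ^ (-(1 / 4) : ℝ) ≤ (r / 4) ^ (-(1 / 4) : ℝ) * |N ξ| ^ (-(1 / 4) : ℝ) := by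
    rw [← Real.mul_rpow (by positivity) (by positivity)]
    refine Real.rpow_le_rpow_of_nonpos (by positivity) ?_ (by norm_num)
    calc r / 4 * |N ξ| = r * (|N ξ| / 4) := by ring
      _ ≤ s * n := by gcongr
  calc C * ‖φ ξ‖ ≤ 16 * (1 + (r / 4) ^ (-(1 / 4) : ℝ) * |N ξ| ^ (-(1 / 4) : ℝ)) * ‖φ ξ‖ := by
        gcongr; linarith
    _ = _ := by rw [boundaryBound]; ring

lemma abs_sign_mul {σ : ℝ} (hσ : σ ^ 2 = 1) (x : ℝ) : |σ * x / 4| = |x| / 4 := by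
  have : |σ| = 1 := by rwa [← sq_eq_sq₀ (abs_nonneg σ) zero_le_one, sq_abs, one_pow]
  rw [abs_div, abs_mul, this, one_mul, abs_of_pos (by norm_num : (0 : ℝ) < 4)]

lemma sign_mul_ne_zero {σ : ℝ} (hσ : σ ^ 2 = 1) {x : ℝ} (hx : x ≠ 0) : σ * x / 4 ≠ 0 := by
  have : σ ≠ 0 := fun h => by simp [h] at hσ
  positivity

lemma integrable_macdonaldBoundary_mul {a : ℂ} (ha : 0 ≤ a.re) (ha0 : a ≠ 0) {σ : ℝ}
    (hσ : σ ^ 2 = 1) (φ : 𝓢(HR, ℂ)) :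
    Integrable fun ξ => macdonaldBoundary a (σ * N ξ / 4) * φ ξ := by
  have h1 := φ.continuous.measurable
  have h2 := continuous_N.measurable
  have h3 := measurable_macdonaldBoundary a
  refine (integrable_boundaryBound ‖a‖ φ).mono' (Measurable.aestronglyMeasurable (by fun_prop)) ?_
  filter_upwards [ae_N_ne_zero] with ξ hξ
  rw [norm_mul]
  exact mul_norm_le_boundaryBound (norm_pos_iff.2 ha0) hξ le_rfl (abs_sign_mul hσ _).ge
    (norm_macdonaldBoundary_le ha ha0 (sign_mul_ne_zero hσ hξ))

lemma integrableOn_mul_exp {α : ℝ} (hα : 0 < α) :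
    IntegrableOn (fun t : ℝ => t * Real.exp (-α * t)) (Ioi 0) := by
  simpa using integrableOn_rpow_mul_exp (s := 1) (by norm_num) hα

lemma integrableOn_mul_cexp {z : ℂ} (hz : 0 < z.re) :
    IntegrableOn (fun t : ℝ => (t : ℂ) * Complex.exp (-z * t)) (Ioi 0) := by
  refine (integrableOn_mul_exp hz).mono' (by fun_prop) ?_
  refine (ae_restrict_iff' measurableSet_Ioi).2 (ae_of_all _ fun t (ht : 0 < t) => ?_)
  rw [norm_mul, norm_cexp_neg_mul, Complex.norm_real, Real.norm_of_nonneg ht.le]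

lemma integral_mul_cexp {z : ℂ} (hz : 0 < z.re) :
    ∫ t in Ioi (0 : ℝ), (t : ℂ) * Complex.exp (-z * t) = 1 / z ^ 2 := by
  have hz0 : z ≠ 0 := fun h => by simp [h] at hz
  have h := integral_Ioi_deriv_eq_zero (f := fun t : ℝ => (t : ℂ) * Complex.exp (-z * t))
    (f' := fun t : ℝ => Complex.exp (-z * t) - z * ((t : ℂ) * Complex.exp (-z * t)))
    (fun t _ => ?_) (integrableOn_mul_cexp hz)
    ((integrableOn_cexp hz).sub ((integrableOn_mul_cexp hz).const_mul z)) ?_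
  · rw [integral_sub (integrableOn_cexp hz) ((integrableOn_mul_cexp hz).const_mul z),
      integral_const_mul, integral_cexp_neg_mul hz] at h
    field_simp at h ⊢
    linear_combination -h
  · refine (((hasDerivAt_id (t : ℂ)).comp_ofReal).mul
      (hasDerivAt_cexp_neg_mul z t)).congr_deriv ?_
    simp only [id_eq]
    ring
  · exact tendsto_nhdsWithin_of_tendsto_nhds (Continuous.tendsto' (by fun_prop) 0 _ (by simp))

lemma norm_mul_macdonaldWeight_le (a : ℂ) {d : ℝ} (hd : 0 < d) {t : ℝ} (ht : 0 < t) :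
    ‖(t : ℂ) * macdonaldWeight a d t‖ ≤ t * Real.exp (-a.re * t) := by
  rw [norm_mul, Complex.norm_real, Real.norm_of_nonneg ht.le]
  gcongr
  exact norm_macdonaldWeight_le a (by simpa using hd.le) ht

lemma integrableOn_mul_macdonaldWeight {a : ℂ} (ha : 0 < a.re) {d : ℝ} (hd : 0 < d) :
    IntegrableOn (fun t : ℝ => (t : ℂ) * macdonaldWeight a d t) (Ioi 0) := by
  refine (integrableOn_mul_exp ha).mono' (Measurable.aestronglyMeasurable (by fun_prop)) ?_
  exact (ae_restrict_iff' measurableSet_Ioi).2 (ae_of_all _ fun t ht =>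
    norm_mul_macdonaldWeight_le a hd ht)

/-- Parseval's formula regularized by the factor `e^{-d/t}`, which makes every integral over `t`
converge absolutely. -/
lemma integral_regularized_mul_fourier {a : ℂ} (ha : 0 < a.re) {σ : ℝ} (hσ : σ ^ 2 = 1) {d : ℝ}
    (hd : 0 < d) (φ : 𝓢(HR, ℂ)) :
    ∫ X, (∫ t in Ioi (0 : ℝ), (t : ℂ) * macdonaldWeight a d t *
        Complex.exp (Complex.I * (σ * t : ℝ) * N X)) * fourier φ X =
      1 / 4 * ∫ ξ, macdonaldIntegral a (d + Complex.I * (σ * N ξ / 4 : ℝ)) * φ ξ := by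
  have hσ0 : σ ≠ 0 := fun h => by simp [h] at hσ
  have hσc : (σ : ℂ) ^ 2 = 1 := by exact_mod_cast hσ
  have hσc0 : (σ : ℂ) ≠ 0 := by exact_mod_cast hσ0
  have hd' : 0 < (d : ℂ).re := by simpa using hd
  have hNc := continuous_N.measurable
  have hφc := φ.continuous.measurable
  have hφf := (continuous_fourier φ).measurable
  have hint1 : Integrable (Function.uncurry fun (X : HR) (t : ℝ) => (t : ℂ) *
      macdonaldWeight a d t * Complex.exp (Complex.I * (σ * t : ℝ) * N X) * fourier φ X)
      (volume.prod (volume.restrict (Ioi 0))) := by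
    refine ((integrable_fourier φ).mul_prod (integrableOn_mul_macdonaldWeight ha hd)).mono
      (Measurable.aestronglyMeasurable ?_) (ae_of_all _ fun p => ?_)
    · simp only [Function.uncurry_def]; fun_prop
    · have h : Complex.I * ((σ * p.2 : ℝ) : ℂ) * (N p.1 : ℂ) =
          ((σ * p.2 * N p.1 : ℝ) : ℂ) * Complex.I := by push_cast; ring
      simp only [Function.uncurry_def, norm_mul, h, Complex.norm_exp_ofReal_mul_I]
      exact le_of_eq (by ring)
  have hint2 : Integrable (Function.uncurry fun (t : ℝ) (ξ : HR) => macdonaldWeight a d t / t *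
      (φ ξ * Complex.exp (-(Complex.I * N ξ / (4 * (σ * t : ℝ))))))
      ((volume.restrict (Ioi 0)).prod volume) := by
    refine ((integrableOn_macdonaldWeight_div ha hd').mul_prod φ.integrable).mono
      (Measurable.aestronglyMeasurable ?_) (ae_of_all _ fun p => ?_)
    · simp only [Function.uncurry_def]; fun_prop
    · have h : -(Complex.I * (N p.2 : ℂ) / (4 * ((σ * p.1 : ℝ) : ℂ))) =
          ((-(N p.2 / (4 * (σ * p.1))) : ℝ) : ℂ) * Complex.I := by push_cast; ring
      simp only [Function.uncurry_def, norm_mul, h, Complex.norm_exp_ofReal_mul_I]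
      exact le_of_eq (by ring)
  calc _ = ∫ X, ∫ t in Ioi (0 : ℝ), (t : ℂ) * macdonaldWeight a d t *
        Complex.exp (Complex.I * (σ * t : ℝ) * N X) * fourier φ X :=
        integral_congr_ae (ae_of_all _ fun X => (integral_mul_const _ _).symm)
    _ = ∫ t in Ioi (0 : ℝ), ∫ X, (t : ℂ) * macdonaldWeight a d t *
        Complex.exp (Complex.I * (σ * t : ℝ) * N X) * fourier φ X := integral_integral_swap hint1
    _ = ∫ t in Ioi (0 : ℝ), 1 / 4 * ∫ ξ, macdonaldWeight a d t / t *
        (φ ξ * Complex.exp (-(Complex.I * N ξ / (4 * (σ * t : ℝ))))) := by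
        refine setIntegral_congr_fun measurableSet_Ioi fun t (ht : 0 < t) => ?_
        have ht' : (t : ℂ) ≠ 0 := by exact_mod_cast ht.ne'
        simp only [mul_assoc ((t : ℂ) * macdonaldWeight a d t)]
        rw [integral_const_mul, integral_const_mul,
          integral_cexp_N_mul_fourier (mul_ne_zero hσ0 ht.ne')]
        push_cast
        rw [mul_pow, hσc, one_mul]
        field_simp
    _ = 1 / 4 * ∫ ξ, ∫ t in Ioi (0 : ℝ), macdonaldWeight a d t / t *
        (φ ξ * Complex.exp (-(Complex.I * N ξ / (4 * (σ * t : ℝ))))) := by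
        rw [integral_const_mul, integral_integral_swap hint2]
    _ = _ := by
        congr 1
        refine integral_congr_ae (ae_of_all _ fun ξ => ?_)
        simp only [macdonaldIntegral]
        rw [← integral_mul_const]
        refine setIntegral_congr_fun measurableSet_Ioi fun t (ht : 0 < t) => ?_
        have ht' : (t : ℂ) ≠ 0 := by exact_mod_cast ht.ne'
        have h : macdonaldWeight a (d + Complex.I * (σ * N ξ / 4 : ℝ)) t =
            macdonaldWeight a d t * Complex.exp (-(Complex.I * N ξ / (4 * (σ * t : ℝ)))) := by
          rw [macdonaldWeight, macdonaldWeight, ← Complex.exp_add]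
          congr 1
          push_cast
          field_simp
          linear_combination -(Complex.I * N ξ) * hσc
        simp only [h]
        ring

lemma re_sub_I_mul (a : ℂ) (σ x : ℝ) : (a - Complex.I * (σ * x : ℝ)).re = a.re := by
  simp

lemma norm_inv_sq_le {a : ℂ} (ha : 0 < a.re) (σ x : ℝ) :
    ‖1 / (a - Complex.I * (σ * x : ℝ)) ^ 2‖ ≤ 1 / a.re ^ 2 := by
  rw [norm_div, norm_one, norm_pow]
  gcongr
  rw [← re_sub_I_mul a σ x]
  exact Complex.re_le_norm _

lemma continuous_inv_sq {a : ℂ} (ha : 0 < a.re) (σ : ℝ) :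
    Continuous fun X : HR => 1 / (a - Complex.I * (σ * N X : ℝ)) ^ 2 := by
  refine continuous_const.div (by fun_prop) fun X => pow_ne_zero 2 fun h => ?_
  have := re_sub_I_mul a σ (N X)
  rw [h, Complex.zero_re] at this
  exact ha.ne this

lemma integrable_inv_sq_mul_fourier {a : ℂ} (ha : 0 < a.re) (σ : ℝ) (φ : 𝓢(HR, ℂ)) :
    Integrable fun X => 1 / (a - Complex.I * (σ * N X : ℝ)) ^ 2 * fourier φ X :=
  (integrable_fourier φ).bdd_mul (continuous_inv_sq ha σ).aestronglyMeasurable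
    (ae_of_all _ fun X => norm_inv_sq_le ha σ (N X))

/-- Parseval's formula: the Fourier transform of `(a - iσN)⁻²` is a boundary value of the Macdonald
integral. -/
theorem integral_inv_sq_mul_fourier {a : ℂ} (ha : 0 < a.re) {σ : ℝ} (hσ : σ ^ 2 = 1)
    (φ : 𝓢(HR, ℂ)) :
    ∫ X, 1 / (a - Complex.I * (σ * N X : ℝ)) ^ 2 * fourier φ X =
      1 / 4 * ∫ ξ, macdonaldBoundary a (σ * N ξ / 4) * φ ξ := by
  have ha0 : a ≠ 0 := fun h => by simp [h] at ha
  have hNc := continuous_N.measurable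
  have hφc := φ.continuous.measurable
  have hφf := (continuous_fourier φ).measurable
  set M := ∫ t in Ioi (0 : ℝ), t * Real.exp (-a.re * t)
  have hnorm : ∀ d : ℝ, 0 < d → ∀ x : ℝ, ∀ t ∈ Ioi (0 : ℝ), ‖(t : ℂ) * macdonaldWeight a d t *
      Complex.exp (Complex.I * (σ * t : ℝ) * x)‖ ≤ t * Real.exp (-a.re * t) :=
    fun d hd x t ht => by
      have h : Complex.I * ((σ * t : ℝ) : ℂ) * (x : ℂ) =
          ((σ * t * x : ℝ) : ℂ) * Complex.I := by push_cast; ring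
      rw [norm_mul, h, Complex.norm_exp_ofReal_mul_I, mul_one]
      exact norm_mul_macdonaldWeight_le a hd ht
  have hK : ∀ x : ℝ, Tendsto (fun d : ℝ => ∫ t in Ioi (0 : ℝ), (t : ℂ) * macdonaldWeight a d t *
      Complex.exp (Complex.I * (σ * t : ℝ) * x)) (𝓝[>] 0)
      (𝓝 (1 / (a - Complex.I * (σ * x : ℝ)) ^ 2)) := fun x => by
    rw [← integral_mul_cexp (by rwa [re_sub_I_mul])]
    refine tendsto_integral_filter_of_dominated_convergence (fun t => t * Real.exp (-a.re * t))
      (Eventually.of_forall fun d => Measurable.aestronglyMeasurable (by fun_prop)) ?_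
      (integrableOn_mul_exp ha) (ae_of_all _ fun t => ?_)
    · filter_upwards [self_mem_nhdsWithin] with d (hd : 0 < d)
      exact (ae_restrict_iff' measurableSet_Ioi).2 (ae_of_all _ (hnorm d hd x))
    · have h := ((tendsto_macdonaldWeight a 1 t).const_mul (t : ℂ)).mul_const
        (Complex.exp (Complex.I * (σ * t : ℝ) * x))
      simp only [mul_one] at h
      convert h using 2
      rw [mul_assoc, ← Complex.exp_add]
      congr 2
      push_cast
      ring
  have hL : Tendsto (fun d : ℝ => ∫ X, (∫ t in Ioi (0 : ℝ), (t : ℂ) * macdonaldWeight a d t *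
      Complex.exp (Complex.I * (σ * t : ℝ) * N X)) * fourier φ X) (𝓝[>] 0)
      (𝓝 (∫ X, 1 / (a - Complex.I * (σ * N X : ℝ)) ^ 2 * fourier φ X)) := by
    refine tendsto_integral_filter_of_dominated_convergence (fun X => M * ‖fourier φ X‖)
      (Eventually.of_forall fun d => ?_) ?_ ((integrable_fourier φ).norm.const_mul M)
      (ae_of_all _ fun X => (hK (N X)).mul_const _)
    · refine AEStronglyMeasurable.mul ?_ hφf.aestronglyMeasurable
      refine StronglyMeasurable.aestronglyMeasurable ?_
      refine StronglyMeasurable.integral_prod_right (f := fun (X : HR) (t : ℝ) =>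
        (t : ℂ) * macdonaldWeight a d t * Complex.exp (Complex.I * (σ * t : ℝ) * N X)) ?_
      refine Measurable.stronglyMeasurable ?_
      simp only [Function.uncurry_def]
      fun_prop
    · filter_upwards [self_mem_nhdsWithin] with d (hd : 0 < d)
      refine ae_of_all _ fun X => ?_
      rw [norm_mul]
      gcongr
      exact norm_integral_le_of_norm_le (integrableOn_mul_exp ha)
        ((ae_restrict_iff' measurableSet_Ioi).2 (ae_of_all _ (hnorm d hd (N X))))
  have hR : Tendsto (fun d : ℝ => ∫ ξ, macdonaldIntegral a (d + Complex.I * (σ * N ξ / 4 : ℝ)) *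
      φ ξ) (𝓝[>] 0) (𝓝 (∫ ξ, macdonaldBoundary a (σ * N ξ / 4) * φ ξ)) := by
    refine tendsto_integral_filter_of_dominated_convergence (boundaryBound ‖a‖ φ) ?_ ?_
      (integrable_boundaryBound _ φ) ?_
    · filter_upwards [self_mem_nhdsWithin] with d (hd : 0 < d)
      have h : (fun ξ : HR => macdonaldIntegral a (d + Complex.I * (σ * N ξ / 4 : ℝ)) * φ ξ) =
          fun ξ => macdonaldSeries (Complex.log a +
            Complex.log (d + Complex.I * (σ * N ξ / 4 : ℝ)))
            (a * (d + Complex.I * (σ * N ξ / 4 : ℝ))) * φ ξ := by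
        funext ξ
        rw [macdonaldIntegral_eq_macdonaldSeries ha (by simpa using hd)]
      rw [h]
      refine Measurable.aestronglyMeasurable (Measurable.mul ?_ hφc)
      exact measurable_macdonaldSeries (by fun_prop) (by fun_prop)
    · filter_upwards [self_mem_nhdsWithin] with d (hd : 0 < d)
      filter_upwards [ae_N_ne_zero] with ξ hξ
      rw [norm_mul]
      refine mul_norm_le_boundaryBound (norm_pos_iff.2 ha0) hξ le_rfl ?_
        (norm_macdonaldIntegral_le ha (by simpa using hd))
      rw [← abs_sign_mul hσ]
      simpa using Complex.abs_im_le_norm ((d : ℂ) + Complex.I * (σ * N ξ / 4 : ℝ))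
    · filter_upwards [ae_N_ne_zero] with ξ hξ
      exact (tendsto_macdonaldIntegral_ofReal_add ha (sign_mul_ne_zero hσ hξ)).mul_const _
  refine tendsto_nhds_unique (hL.congr' ?_) (hR.const_mul (1 / 4))
  filter_upwards [self_mem_nhdsWithin] with d (hd : 0 < d)
  exact integral_regularized_mul_fourier ha hσ hd φ

/-! ### The limit of the Fourier transforms -/

/-- The point `ε + iσc` at which the transform of `(N - c + iσε)⁻²` is evaluated. -/
def spectralPoint (c σ ε : ℝ) : ℂ := ε + Complex.I * (σ * c : ℝ)

/-- The function `-¼ (u₁ + s u₋₁)`, where `u_σ(η)` is the boundary value of the Macdonald integral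
at `(ε + iσc, iσN(η)/4)`.  For `ε > 0` it is the Fourier transform of
`(N - c + iε)⁻² + s (N - c - iε)⁻²`. -/
def kernelTransform (c : ℝ) (s : ℂ) (ε : ℝ) (η : HR) : ℂ :=
  -(1 / 4) * (macdonaldBoundary (spectralPoint c 1 ε) (1 * N η / 4) +
    s * macdonaldBoundary (spectralPoint c (-1) ε) (-1 * N η / 4))

/-- The kernel `(N - c + iε)⁻² + s (N - c - iε)⁻²`. -/
def mixedKernel (c : ℝ) (s : ℂ) (ε : ℝ) (X : HR) : ℂ :=
  1 / ((N X : ℂ) - c + Complex.I * ε) ^ 2 + s * (1 / ((N X : ℂ) - c - Complex.I * ε) ^ 2)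

lemma re_spectralPoint (c σ ε : ℝ) : (spectralPoint c σ ε).re = ε := by simp [spectralPoint]

lemma im_spectralPoint (c σ ε : ℝ) : (spectralPoint c σ ε).im = σ * c := by simp [spectralPoint]

lemma le_norm_spectralPoint {c σ : ℝ} (hc : 0 < c) (hσ : σ ^ 2 = 1) (ε : ℝ) :
    c ≤ ‖spectralPoint c σ ε‖ := by
  have h := Complex.abs_im_le_norm (spectralPoint c σ ε)
  have hσ1 : |σ| = 1 := by rwa [← sq_eq_sq₀ (abs_nonneg σ) zero_le_one, sq_abs, one_pow]
  rwa [im_spectralPoint, abs_mul, hσ1, one_mul, abs_of_pos hc] at h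

lemma spectralPoint_ne_zero {c σ : ℝ} (hc : 0 < c) (hσ : σ ^ 2 = 1) (ε : ℝ) :
    spectralPoint c σ ε ≠ 0 :=
  norm_pos_iff.1 (hc.trans_le (le_norm_spectralPoint hc hσ ε))

lemma spectralPoint_mem_slitPlane {c σ ε : ℝ} (hc : 0 < c) (hσ : σ ^ 2 = 1) (hε : 0 ≤ ε) :
    spectralPoint c σ ε ∈ Complex.slitPlane :=
  mem_slitPlane_of_re_nonneg (by rwa [re_spectralPoint]) (spectralPoint_ne_zero hc hσ ε)

lemma mixedKernel_eq (c : ℝ) (s : ℂ) (ε : ℝ) (X : HR) :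
    mixedKernel c s ε X = -(1 / (spectralPoint c 1 ε - Complex.I * (1 * N X : ℝ)) ^ 2 +
      s * (1 / (spectralPoint c (-1) ε - Complex.I * (-1 * N X : ℝ)) ^ 2)) := by
  have h1 : (spectralPoint c 1 ε - Complex.I * (1 * N X : ℝ)) ^ 2 =
      -((N X : ℂ) - c + Complex.I * ε) ^ 2 := by
    simp only [spectralPoint]; push_cast
    linear_combination ((c - N X : ℂ) ^ 2 + (ε : ℂ) ^ 2) * Complex.I_sq
  have h2 : (spectralPoint c (-1) ε - Complex.I * (-1 * N X : ℝ)) ^ 2 =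
      -((N X : ℂ) - c - Complex.I * ε) ^ 2 := by
    simp only [spectralPoint]; push_cast
    linear_combination ((c - N X : ℂ) ^ 2 + (ε : ℂ) ^ 2) * Complex.I_sq
  rw [mixedKernel, h1, h2, one_div_neg_eq_neg_one_div, one_div_neg_eq_neg_one_div]
  ring

lemma integrable_kernelTransform_mul {c : ℝ} (hc : 0 < c) (s : ℂ) {ε : ℝ} (hε : 0 ≤ ε)
    (φ : 𝓢(HR, ℂ)) : Integrable fun ξ => kernelTransform c s ε ξ * φ ξ := by
  have h : ∀ σ : ℝ, σ ^ 2 = 1 → Integrable fun ξ =>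
      macdonaldBoundary (spectralPoint c σ ε) (σ * N ξ / 4) * φ ξ := fun σ hσ =>
    integrable_macdonaldBoundary_mul (by rwa [re_spectralPoint])
      (spectralPoint_ne_zero hc hσ ε) hσ φ
  refine (((h 1 (by norm_num)).add ((h (-1) (by norm_num)).const_mul s)).const_mul
    (-(1 / 4))).congr (ae_of_all _ fun ξ => ?_)
  simp only [kernelTransform, Pi.add_apply]
  ring

lemma isFourierTransform_kernelTransform {c : ℝ} (hc : 0 < c) (s : ℂ) {ε : ℝ} (hε : 0 < ε) :
    IsFourierTransform (mixedKernel c s ε) (kernelTransform c s ε) := fun φ => by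
  have hre : ∀ σ : ℝ, 0 < (spectralPoint c σ ε).re := fun σ => by rwa [re_spectralPoint]
  have i1 := integrable_inv_sq_mul_fourier (hre 1) 1 φ
  have i2 := (integrable_inv_sq_mul_fourier (hre (-1)) (-1) φ).const_mul s
  have j1 := integrable_macdonaldBoundary_mul (hre 1).le (spectralPoint_ne_zero hc (by norm_num) ε)
    (σ := 1) (by norm_num) φ
  have j2 := (integrable_macdonaldBoundary_mul (hre (-1)).le
    (spectralPoint_ne_zero hc (by norm_num) ε) (σ := -1) (by norm_num) φ).const_mul s
  have e : (fun X => mixedKernel c s ε X * fourier φ X) = fun X =>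
      -(1 / (spectralPoint c 1 ε - Complex.I * (1 * N X : ℝ)) ^ 2 * fourier φ X +
      s * (1 / (spectralPoint c (-1) ε - Complex.I * (-1 * N X : ℝ)) ^ 2 * fourier φ X)) := by
    funext X
    rw [mixedKernel_eq]
    ring
  have e' : (fun ξ => kernelTransform c s ε ξ * φ ξ) = fun ξ =>
      -(1 / 4) * (macdonaldBoundary (spectralPoint c 1 ε) (1 * N ξ / 4) * φ ξ +
      s * (macdonaldBoundary (spectralPoint c (-1) ε) (-1 * N ξ / 4) * φ ξ)) := by
    funext ξ
    rw [kernelTransform]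
    ring
  refine ⟨?_, integrable_kernelTransform_mul hc s hε.le φ, ?_⟩
  · rw [e]
    exact (i1.add i2).neg
  · rw [e, e', integral_neg, integral_add i1 i2, integral_const_mul, integral_add j1 j2,
      integral_const_mul, integral_const_mul, integral_inv_sq_mul_fourier (hre 1) (by norm_num),
      integral_inv_sq_mul_fourier (hre (-1)) (by norm_num)]
    ring

lemma tendsto_macdonaldBoundary_spectralPoint {c σ : ℝ} (hc : 0 < c) (hσ : σ ^ 2 = 1) {y : ℝ}
    (hy : y ≠ 0) : Tendsto (fun ε => macdonaldBoundary (spectralPoint c σ ε) y) (𝓝[>] 0)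
      (𝓝 (macdonaldBoundary (spectralPoint c σ 0) y)) := by
  refine tendsto_macdonaldSeries_log (spectralPoint_mem_slitPlane hc hσ le_rfl)
    (I_mul_mem_slitPlane hy) ?_ tendsto_const_nhds
  unfold spectralPoint
  exact tendsto_nhdsWithin_of_tendsto_nhds (Continuous.tendsto (by fun_prop) 0)

lemma tendsto_kernelTransform {c : ℝ} (hc : 0 < c) (s : ℂ) {η : HR} (hη : N η ≠ 0) :
    Tendsto (fun ε => kernelTransform c s ε η) (𝓝[>] 0) (𝓝 (kernelTransform c s 0 η)) :=
  ((tendsto_macdonaldBoundary_spectralPoint hc (by norm_num)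
      (sign_mul_ne_zero (by norm_num) hη)).add
    ((tendsto_macdonaldBoundary_spectralPoint hc (by norm_num)
      (sign_mul_ne_zero (by norm_num) hη)).const_mul s)).const_mul _

lemma norm_kernelTransform_mul_le {c : ℝ} (hc : 0 < c) (s : ℂ) {ε : ℝ} (hε : 0 ≤ ε)
    (φ : HR → ℂ) {ξ : HR} (hξ : N ξ ≠ 0) :
    ‖kernelTransform c s ε ξ * φ ξ‖ ≤ (1 + ‖s‖) * boundaryBound c φ ξ := by
  have h : ∀ σ : ℝ, σ ^ 2 = 1 →
      ‖macdonaldBoundary (spectralPoint c σ ε) (σ * N ξ / 4)‖ * ‖φ ξ‖ ≤ boundaryBound c φ ξ :=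
    fun σ hσ => mul_norm_le_boundaryBound hc hξ (le_norm_spectralPoint hc hσ ε)
      (abs_sign_mul hσ _).ge (norm_macdonaldBoundary_le (by rwa [re_spectralPoint])
        (spectralPoint_ne_zero hc hσ ε) (sign_mul_ne_zero hσ hξ))
  have h1 := h 1 (by norm_num)
  have h2 := h (-1) (by norm_num)
  set u := macdonaldBoundary (spectralPoint c 1 ε) (1 * N ξ / 4)
  set v := macdonaldBoundary (spectralPoint c (-1) ε) (-1 * N ξ / 4)
  have h3 : ‖kernelTransform c s ε ξ‖ ≤ ‖u‖ + ‖s‖ * ‖v‖ := by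
    rw [kernelTransform, norm_mul, ← norm_mul s]
    refine le_trans (mul_le_of_le_one_left (norm_nonneg _) (by norm_num)) (norm_add_le _ _)
  rw [norm_mul]
  calc _ ≤ (‖u‖ + ‖s‖ * ‖v‖) * ‖φ ξ‖ := by gcongr
    _ = ‖u‖ * ‖φ ξ‖ + ‖s‖ * (‖v‖ * ‖φ ξ‖) := by ring
    _ ≤ boundaryBound c φ ξ + ‖s‖ * boundaryBound c φ ξ := by gcongr
    _ = _ := by ring

lemma mem_nullCone_iff {η : HR} : η ∈ nullCone ↔ N η = 0 := by
  have : form η η = N η := by simp only [form, N]; ring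
  rw [nullCone, mem_ofPred_eq, this]

lemma continuousOn_kernelTransform {c : ℝ} (hc : 0 < c) (s : ℂ) {ε : ℝ} (hε : 0 ≤ ε) :
    ContinuousOn (kernelTransform c s ε) nullConeᶜ := by
  have h : ∀ σ : ℝ, σ ^ 2 = 1 → ContinuousOn (fun η : HR =>
      macdonaldBoundary (spectralPoint c σ ε) (σ * N η / 4)) nullConeᶜ := fun σ hσ =>
    (continuousOn_macdonaldBoundary (spectralPoint_mem_slitPlane hc hσ hε)).comp
      (Continuous.continuousOn (by fun_prop))
      fun η hη => sign_mul_ne_zero hσ fun h0 => hη (mem_nullCone_iff.2 h0)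
  exact ((h 1 (by norm_num)).add ((h (-1) (by norm_num)).const_smul s)).const_smul (-(1 / 4) : ℂ)

theorem isLimitFourierTransform_kernelTransform {c : ℝ} (hc : 0 < c) (s : ℂ) :
    IsLimitFourierTransform (mixedKernel c s) (kernelTransform c s 0) where
  continuousOn := continuousOn_kernelTransform hc s le_rfl
  integrable := integrable_kernelTransform_mul hc s le_rfl
  distributional φ := by
    have h : Tendsto (fun ε => ∫ ξ, kernelTransform c s ε ξ * φ ξ) (𝓝[>] 0)
        (𝓝 (∫ ξ, kernelTransform c s 0 ξ * φ ξ)) := by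
      refine tendsto_integral_filter_of_dominated_convergence
        (fun ξ => (1 + ‖s‖) * boundaryBound c φ ξ) ?_ ?_
        ((integrable_boundaryBound c φ).const_mul _) ?_
      · filter_upwards [self_mem_nhdsWithin] with ε (hε : 0 < ε)
        exact (integrable_kernelTransform_mul hc s hε.le φ).aestronglyMeasurable
      · filter_upwards [self_mem_nhdsWithin] with ε (hε : 0 < ε)
        filter_upwards [ae_N_ne_zero] with ξ hξ
        exact norm_kernelTransform_mul_le hc s hε.le φ hξ
      · filter_upwards [ae_N_ne_zero] with ξ hξ
        exact (tendsto_kernelTransform hc s hξ).mul_const _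
    refine h.congr' ?_
    filter_upwards [self_mem_nhdsWithin] with ε (hε : 0 < ε)
    exact (isFourierTransform_kernelTransform hc s hε φ).2.2
  pointwise := ⟨kernelTransform c s,
    fun ε hε => ⟨continuousOn_kernelTransform hc s (le_of_lt hε),
      isFourierTransform_kernelTransform hc s hε⟩,
    fun η hη => tendsto_kernelTransform hc s fun h0 => hη (mem_nullCone_iff.2 h0)⟩

/-! ### Values in terms of Bessel functions -/

lemma ofReal_besselJ0 (x : ℝ) : (besselJ0 x : ℂ) = besselSeries (-(x ^ 2 / 4 : ℝ)) := by
  rw [besselJ0, besselSeries, Complex.ofReal_tsum]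
  refine tsum_congr fun k => ?_
  push_cast
  rw [neg_pow (_ / _ : ℂ)]; ring

lemma ofReal_besselI0 (x : ℝ) : (besselI0 x : ℂ) = besselSeries (x ^ 2 / 4 : ℝ) := by
  rw [besselI0, besselSeries, Complex.ofReal_tsum]
  refine tsum_congr fun k => ?_
  push_cast; ring

lemma ofReal_besselY0 (x : ℝ) : (besselY0 x : ℂ) =
    2 / Real.pi * ((Real.log (x / 2) + Real.eulerMascheroniConstant) *
      besselSeries (-(x ^ 2 / 4 : ℝ)) - harmonicSeries (-(x ^ 2 / 4 : ℝ))) := by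
  rw [besselY0, harmonicSeries, ← ofReal_besselJ0]
  push_cast
  congr 2
  refine tsum_congr fun k => ?_
  rw [neg_pow (_ / _ : ℂ)]; ring

lemma ofReal_besselK0 (x : ℝ) : (besselK0 x : ℂ) =
    -(Real.log (x / 2) + Real.eulerMascheroniConstant) * besselSeries (x ^ 2 / 4 : ℝ) +
      harmonicSeries (x ^ 2 / 4 : ℝ) := by
  rw [besselK0, harmonicSeries, ← ofReal_besselI0]
  push_cast
  congr 1
  refine tsum_congr fun k => ?_
  ring

lemma log_I_mul_of_pos {y : ℝ} (hy : 0 < y) :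
    Complex.log (Complex.I * y) = Real.log y + Real.pi / 2 * Complex.I := by
  rw [mul_comm, Complex.log_ofReal_mul hy Complex.I_ne_zero, Complex.log_I]

lemma log_I_mul_of_neg {y : ℝ} (hy : y < 0) :
    Complex.log (Complex.I * y) = Real.log y - Real.pi / 2 * Complex.I := by
  have h : Complex.I * (y : ℂ) = ((-y : ℝ) : ℂ) * -Complex.I := by push_cast; ring
  rw [h, Complex.log_ofReal_mul (neg_pos.2 hy) (neg_ne_zero.2 Complex.I_ne_zero),
    Complex.log_neg_I, Real.log_neg_eq_log]
  ring

lemma spectralPoint_zero (c σ : ℝ) : spectralPoint c σ 0 = Complex.I * (σ * c : ℝ) := by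
  simp [spectralPoint]

lemma I_mul_mul_I_mul (x y : ℝ) : Complex.I * x * (Complex.I * y) = (-(x * y) : ℝ) := by
  push_cast
  linear_combination (x * y : ℂ) * Complex.I_sq

/-- For `N(η) > 0` the two logarithms have the imaginary parts `±π`. -/
lemma kernelTransform_zero_of_pos {c : ℝ} (hc : 0 < c) (s : ℂ) {η : HR} (hη : 0 < N η) :
    kernelTransform c s 0 η = -(1 / 4) *
      (macdonaldSeries (Real.log (c * N η / 4) + Real.pi * Complex.I) (-(c * N η / 4) : ℝ) +
      s * macdonaldSeries (Real.log (c * N η / 4) - Real.pi * Complex.I) (-(c * N η / 4) : ℝ)) := by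
  have hlog : Real.log (c * N η / 4) = Real.log c + Real.log (N η / 4) := by
    rw [mul_div_assoc, Real.log_mul hc.ne' (by positivity)]
  have e1 : (1 : ℝ) * N η / 4 = N η / 4 := by ring
  have e2 : (-1 : ℝ) * N η / 4 = -(N η / 4) := by ring
  rw [kernelTransform, macdonaldBoundary, macdonaldBoundary, spectralPoint_zero,
    spectralPoint_zero, e1, e2, one_mul, neg_one_mul, I_mul_mul_I_mul, I_mul_mul_I_mul,
    log_I_mul_of_pos hc, log_I_mul_of_pos (by positivity), log_I_mul_of_neg (by linarith),
    log_I_mul_of_neg (by linarith), Real.log_neg_eq_log, Real.log_neg_eq_log, hlog]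
  congr 3
  · push_cast; ring_nf
  · push_cast; ring_nf
  · push_cast; ring_nf

/-- For `N(η) < 0` the two logarithms agree. -/
lemma kernelTransform_zero_of_neg {c : ℝ} (hc : 0 < c) (s : ℂ) {η : HR} (hη : N η < 0) :
    kernelTransform c s 0 η = -(1 / 4) * ((1 + s) *
      macdonaldSeries (Real.log (-(c * N η / 4))) (-(c * N η / 4) : ℝ)) := by
  have hlog : Real.log (-(c * N η / 4)) = Real.log c + Real.log (N η / 4) := by
    rw [Real.log_neg_eq_log, mul_div_assoc, Real.log_mul hc.ne' (by linarith [hη] |> ne_of_lt)]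
  have e1 : (1 : ℝ) * N η / 4 = N η / 4 := by ring
  have e2 : (-1 : ℝ) * N η / 4 = -(N η / 4) := by ring
  rw [kernelTransform, macdonaldBoundary, macdonaldBoundary, spectralPoint_zero,
    spectralPoint_zero, e1, e2, one_mul, neg_one_mul, I_mul_mul_I_mul, I_mul_mul_I_mul,
    log_I_mul_of_pos hc, log_I_mul_of_neg (by linarith : N η / 4 < 0),
    log_I_mul_of_neg (by linarith : -c < 0), log_I_mul_of_pos (by linarith : 0 < -(N η / 4)),
    Real.log_neg_eq_log, Real.log_neg_eq_log, hlog, one_add_mul]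
  congr 3
  · push_cast; ring_nf
  · push_cast; ring_nf
  · push_cast; ring_nf

lemma N_sub_of_mem_nullCone {ξ ξ' : HR} (hξ : ξ ∈ nullCone) (hξ' : ξ' ∈ nullCone) :
    N (ξ - ξ') = -2 * form ξ ξ' := by
  simp only [nullCone, mem_ofPred_eq, form] at hξ hξ'
  simp only [N, form, PiLp.sub_apply]
  linear_combination hξ + hξ'

lemma sumKernel_eq (c : ℝ) : sumKernel c = mixedKernel c 1 := by
  funext ε X
  rw [sumKernel, mixedKernel, one_mul]

lemma diffKernel_eq (c : ℝ) : diffKernel c = mixedKernel c (-1) := by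
  funext ε X
  rw [diffKernel, mixedKernel]
  ring

lemma kernelTransform_one_eq_Psi0 {η : HR} (hη : N η ≠ 0) :
    kernelTransform 4 1 0 η = (Real.pi / 2 * Psi0 (N η / 2) : ℝ) := by
  have hpi : (Real.pi : ℂ) ≠ 0 := by exact_mod_cast Real.pi_ne_zero
  have e4 : (4 : ℝ) * N η / 4 = N η := by ring
  rcases hη.lt_or_gt with h | h
  · have e1 : (2 * √(-2 * (N η / 2))) ^ 2 / 4 = -N η := by
      rw [mul_pow, Real.sq_sqrt (by linarith)]; ring
    have e2 : Real.log (2 * √(-2 * (N η / 2)) / 2) = Real.log (-N η) / 2 := by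
      rw [mul_div_cancel_left₀ _ two_ne_zero, Real.log_sqrt (by linarith)]
      congr 2; ring
    rw [kernelTransform_zero_of_neg (by norm_num) _ h, Psi0, if_neg (by linarith), e4]
    push_cast
    rw [ofReal_besselK0, e1, e2, macdonaldSeries]
    push_cast
    field_simp
    ring
  · have e1 : (2 * √(2 * (N η / 2))) ^ 2 / 4 = N η := by
      rw [mul_pow, Real.sq_sqrt (by linarith)]; ring
    have e2 : Real.log (2 * √(2 * (N η / 2)) / 2) = Real.log (N η) / 2 := by
      rw [mul_div_cancel_left₀ _ two_ne_zero, Real.log_sqrt (by linarith)]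
      congr 2; ring
    rw [kernelTransform_zero_of_pos (by norm_num) _ h, Psi0, if_pos (by linarith), e4]
    push_cast
    rw [ofReal_besselY0, e1, e2, macdonaldSeries, macdonaldSeries]
    push_cast
    field_simp
    ring

lemma kernelTransform_neg_one_of_pos {R : ℝ} (hR : 0 < R) {η : HR} (h : 0 < N η) :
    kernelTransform (R ^ 2) (-1) 0 η = Real.pi * Complex.I / 2 * (besselJ0 (R * √(N η)) : ℝ) := by
  have e1 : (R * √(N η)) ^ 2 / 4 = R ^ 2 * N η / 4 := by rw [mul_pow, Real.sq_sqrt h.le]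
  rw [kernelTransform_zero_of_pos (by positivity) _ h, ofReal_besselJ0, e1, macdonaldSeries,
    macdonaldSeries]
  push_cast
  ring

lemma kernelTransform_neg_one_of_neg {c : ℝ} (hc : 0 < c) {η : HR} (h : N η < 0) :
    kernelTransform c (-1) 0 η = 0 := by
  rw [kernelTransform_zero_of_neg hc _ h]
  ring

end SplitQuaternion

end

theorem mainTheorem4 (R : ℝ) (hR : 0 < R) :
    (∃ F : SplitQuaternion.HR → ℂ,
      SplitQuaternion.IsLimitFourierTransform (SplitQuaternion.sumKernel 4) F ∧
      ∀ ξ ∈ SplitQuaternion.nullCone, ∀ ξ' ∈ SplitQuaternion.nullCone,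
        SplitQuaternion.form ξ ξ' ≠ 0 →
          F (ξ - ξ') =
            (Real.pi / 2 * SplitQuaternion.Psi0 (-SplitQuaternion.form ξ ξ') : ℝ)) ∧
    (∃ F : SplitQuaternion.HR → ℂ,
      SplitQuaternion.IsLimitFourierTransform (SplitQuaternion.diffKernel (R ^ 2)) F ∧
      ∀ ξ ∈ SplitQuaternion.nullCone, ∀ ξ' ∈ SplitQuaternion.nullCone,
        (0 < SplitQuaternion.form ξ ξ' → F (ξ - ξ') = 0) ∧
        (SplitQuaternion.form ξ ξ' < 0 →
          F (ξ - ξ') = Real.pi * Complex.I / 2 *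
            (SplitQuaternion.besselJ0 (R * √(-2 * SplitQuaternion.form ξ ξ')) : ℝ)) ∧
        (SplitQuaternion.form ξ ξ' ≠ 0 →
          F (ξ - ξ') = Real.pi * Complex.I / 2 *
            (SplitQuaternion.Phi0Plus (-(R ^ 2 / 4) * SplitQuaternion.form ξ ξ') : ℝ))) := by
  open SplitQuaternion in
  refine ⟨⟨kernelTransform 4 1 0, ?_, fun ξ hξ ξ' hξ' h => ?_⟩,
    ⟨kernelTransform (R ^ 2) (-1) 0, ?_, fun ξ hξ ξ' hξ' => ?_⟩⟩
  · rw [sumKernel_eq]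
    exact isLimitFourierTransform_kernelTransform (by norm_num) 1
  · have hN := N_sub_of_mem_nullCone hξ hξ'
    rw [kernelTransform_one_eq_Psi0 (by rw [hN]; simpa using h), hN]
    congr 3
    ring
  · rw [diffKernel_eq]
    exact isLimitFourierTransform_kernelTransform (by positivity) (-1)
  · have hN := N_sub_of_mem_nullCone hξ hξ'
    have hpos : 0 < form ξ ξ' → kernelTransform (R ^ 2) (-1) 0 (ξ - ξ') = 0 := fun h =>
      kernelTransform_neg_one_of_neg (by positivity) (by rw [hN]; linarith)
    have hneg : form ξ ξ' < 0 → kernelTransform (R ^ 2) (-1) 0 (ξ - ξ') =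
        Real.pi * Complex.I / 2 * (besselJ0 (R * √(-2 * form ξ ξ')) : ℝ) := fun h => by
      rw [kernelTransform_neg_one_of_pos hR (by rw [hN]; linarith), hN]
    refine ⟨hpos, hneg, fun h => ?_⟩
    have hR2 : 0 < R ^ 2 / 4 := by positivity
    rcases h.lt_or_gt with h | h
    · have e : 2 * √(2 * (-(R ^ 2 / 4) * form ξ ξ')) = R * √(-2 * form ξ ξ') := by
        have : 2 * (-(R ^ 2 / 4) * form ξ ξ') = (R / 2) ^ 2 * (-2 * form ξ ξ') := by ring
        rw [this, Real.sqrt_mul (sq_nonneg _), Real.sqrt_sq (by positivity)]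
        ring
      rw [hneg h, Phi0Plus, if_pos (by nlinarith), e]
    · rw [hpos h, Phi0Plus, if_neg (by nlinarith)]
      simp
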